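/- Let $d\ge 1$, let $\mathcal A$ be a finite alphabet, and let $F$ be a recursively enumerable set of $d$-dimensional patterns over $\mathcal A$ (elements of $\mathcal A^{U}$ with $U\subset\mathbb Z^d$ finite), enumerated by a Turing machine $\mathcal M_F$. Let $\Sigma=\mathbf T_F\subset\mathcal A^{\mathbb Z^d}$ be the effective subshift of the configurations in which no pattern of $F$ appears, and suppose that $\Sigma$ contains a periodic point (a configuration with $d$ independent periods, i.e. with finite orbit under the shift). Then there are a finite alphabet $\mathcal B$, a finite set $G$ of $(d+1)$-dimensional patterns over $\mathcal B$, defining the subshift of finite type $\mathbf T=\mathbf T_G\subset\mathcal B^{\mathbb Z^{d+1}}$, and a factor map $\pi:\mathcal B^{\mathbb Z^{d+1}}\to\mathcal A^{\mathbb Z^{d+1}}$ such that $$\mathbf{SA}_d(\pi(\mathbf T))=\Sigma\qquad\text{and}\qquad \varphi_{G,\pi,d+1\to d}\sim \mathrm{Dtime}^{\mathrm{enu}}_{\mathcal M_F}.$$ Here the following notation is used. * $\mathbf{SA}_d$ restricts configurations of $\mathbb Z^{d+1}$ to $\mathbb Z^d\times\{0\}$. * $\mathbf T_G^{n}$ is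 the set of all $x\in\mathcal B^{\mathbb Z^d\times[-n,n]}$ in which no pattern of $G$ appears, and $\varphi_{G,\pi,d+1\to d}(k)$ is the least $n$ (large enough for $\mathbf{SA}_d\circ\pi$ to be defined on $\mathbf T_G^n$) such that every $u\in\mathcal A^{[0,k-1]^d}$ which is not in the language of $\mathbf{SA}_d(\pi(\mathbf T_G))$ is not in the language of $\mathbf{SA}_d(\pi(\mathbf T_G^n))$. * $\mathcal M_F$ is a deterministic multitape Turing machine with two-way infinite tapes. Started on empty tapes, it writes on its first tape the patterns of $F$, and only those, as words delimited by a separator $\$$; what has been written on this tape is never changed. A word describes a pattern as follows: a pointer starts at the origin of $\mathbb Z^d$; a letter $a\in\mathcal A$ in the word says that the pattern has the letter $a$ at the pointer, and then moves the pointer by $e_1$; further symbols move the pointer by $\pm e_i$. (For $d=1$, a word over $\mathcal A$ describes itself.) A pattern has been generated at time $t$ if after $t$ steps the first tape contains $\$w\$$ for a word $w$ that describes it. * $\mathrm{Dtime}^{\mathrm{enu}}_{\mathcal M_F}(k)$ is the least $t$ such that, $F_t$ being the set of patterns generated at time $t$, every $u\in\mathcal A^{[0,k-1]^d}$ which is not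 in the language of $\mathbf T_F$ is not in the language of $\mathbf T_{F_t}$. * $\varphi\prec\psi$ means that there are $r,M\in\mathbb N$ with $\varphi(k)\le M\psi(k+r)$ for all $k\in\mathbb N$, and $\varphi\sim\psi$ means $\varphi\prec\psi$ and $\psi\prec\varphi$. -/

import Mathlib

/-- The lattice `ℤ^d`. -/
abbrev IntLattice (d : ℕ) : Type := Fin d → ℤ

/-- A `d`-dimensional pattern over `A`: an element of `A ^ U` for a finite `U ⊂ ℤ^d`. -/
structure Pattern (d : ℕ) (A : Type*) where
  support : Finset (IntLattice d)
  val : support → A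

/-- `p ⊏ x`: some translate of `p` is a restriction of the configuration `x`. -/
def Pattern.AppearsIn {d : ℕ} {A : Type*} (p : Pattern d A) (x : IntLattice d → A) : Prop :=
  ∃ i : IntLattice d, ∀ u : p.support, x (i + u) = p.val u

/-- The subshift `𝐓_F` of the configurations in which no pattern of `F` appears. -/
def subshift {d : ℕ} {A : Type*} (F : Set (Pattern d A)) : Set (IntLattice d → A) :=
  {x | ∀ p ∈ F, ¬ p.AppearsIn x}

/-- The language of a set of configurations. -/
def language {d : ℕ} {A : Type*} (S : Set (IntLattice d → A)) : Set (Pattern d A) :=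
  {p | ∃ x ∈ S, p.AppearsIn x}

/-- The cube `[0, k - 1]^d`. -/
noncomputable def cube (d k : ℕ) : Finset (IntLattice d) :=
  Fintype.piFinset fun _ => Finset.Ico (0 : ℤ) (k : ℤ)

/-- A periodic point: a configuration with `d` independent periods, that is, with a finite
orbit under the shift. -/
def IsPeriodicPoint {d : ℕ} {A : Type*} (x : IntLattice d → A) : Prop :=
  ∃ N : ℕ, 0 < N ∧ ∀ i v : IntLattice d, x (i + N • v) = x i

/-- A factor map `B ^ (ℤ^m) → A ^ (ℤ^m)`, given by a neighbourhood and a local rule. -/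
structure FactorMap (m : ℕ) (B A : Type*) where
  neighborhood : Finset (IntLattice m)
  rule : (neighborhood → B) → A

/-- The action of a factor map on configurations. -/
def FactorMap.apply {m : ℕ} {B A : Type*} (π : FactorMap m B A) (x : IntLattice m → B) :
    IntLattice m → A :=
  fun i => π.rule fun u => x (i + u)

/-- The restriction of a configuration of `ℤ^(d+1)` to the sublattice `ℤ^d × {0}`. -/
def subaction {d : ℕ} {A : Type*} (x : IntLattice (d + 1) → A) : IntLattice d → A :=
  fun i => x (Fin.snoc (α := fun _ => ℤ) i 0)

/-- The strip `ℤ^d × [-n, n]`. -/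
def strip (d n : ℕ) : Set (IntLattice (d + 1)) :=
  {z | -(n : ℤ) ≤ z (Fin.last d) ∧ z (Fin.last d) ≤ n}

/-- The `n`-approximation row of `𝐓_G`: no pattern of `G` appears inside `ℤ^d × [-n, n]`.
Its elements are given by arbitrary extensions to `ℤ^(d+1)`; the values outside the strip are
not constrained. -/
def approxRow {d : ℕ} {B : Type*} (G : Set (Pattern (d + 1) B)) (n : ℕ) :
    Set (IntLattice (d + 1) → B) :=
  {x | ∀ p ∈ G, ∀ i : IntLattice (d + 1), (∀ u : p.support, i + u ∈ strip d n) →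
    ¬ ∀ u : p.support, x (i + u) = p.val u}

/-- The speed of convergence `φ_{G, π, d+1 → d}`: the least `n` such that every pattern of support
`[0, k - 1]^d` that is not in the language of `SA_d (π (𝐓_G))` is not in the language of
`SA_d (π (𝐓_G^n))`. Here `n` is large enough for `SA_d ∘ π` to be determined by the strip. (By
compactness such an `n` exists if `G` is finite and the alphabets are finite.) -/
noncomputable def convergenceSpeed {d : ℕ} {B A : Type*} (G : Set (Pattern (d + 1) B))
    (π : FactorMap (d + 1) B A) (k : ℕ) : ℕ :=
  sInf {n : ℕ | (∀ u ∈ π.neighborhood, u ∈ strip d n) ∧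
    ∀ u : Pattern d A, u.support = cube d k →
      u ∉ language ((fun x => subaction (π.apply x)) '' subshift G) →
      u ∉ language ((fun x => subaction (π.apply x)) '' approxRow G n)}

/-- `φ ≺ ψ`. -/
def Dominated (φ ψ : ℕ → ℕ) : Prop :=
  ∃ r M : ℕ, ∀ k, φ k ≤ M * ψ (k + r)

/-- `φ ∼ ψ`. -/
def SpeedEquiv (φ ψ : ℕ → ℕ) : Prop :=
  Dominated φ ψ ∧ Dominated ψ φ

/-- Head moves of a Turing machine. -/
inductive HeadMove
  | left
  | stay
  | right

/-- The displacement of the head. -/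
def HeadMove.toInt : HeadMove → ℤ
  | .left => -1
  | .stay => 0
  | .right => 1

/-- A Turing machine with `k` two-way infinite tapes, states `Q` and tape alphabet `Γ`. -/
structure TuringMachine (k : ℕ) (Q Γ : Type*) where
  blank : Γ
  start : Q
  trans : Q → (Fin k → Γ) → Q × (Fin k → Γ) × (Fin k → HeadMove)
  final : Set Q

/-- Instantaneous descriptions. -/
structure TuringMachine.Config (k : ℕ) (Q Γ : Type*) where
  state : Q
  head : Fin k → ℤ
  tape : Fin k → ℤ → Γ

/-- One application of the transition function; the machine stops in a final state. -/
noncomputable def TuringMachine.step {k : ℕ} {Q Γ : Type*} (M : TuringMachine k Q Γ)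
    (c : TuringMachine.Config k Q Γ) : TuringMachine.Config k Q Γ :=
  open Classical in
  if c.state ∈ M.final then c
  else
    let next := M.trans c.state fun j => c.tape j (c.head j)
    { state := next.1
      head := fun j => c.head j + (next.2.2 j).toInt
      tape := fun j => Function.update (c.tape j) (c.head j) (next.2.1 j) }

/-- The instantaneous description after `t` steps, starting on empty tapes. -/
noncomputable def TuringMachine.run {k : ℕ} {Q Γ : Type*} (M : TuringMachine k Q Γ) :
    ℕ → TuringMachine.Config k Q Γ
  | 0 => { state := M.start, head := fun _ => 0, tape := fun _ _ => M.blank }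
  | t + 1 => M.step (M.run t)

/-- The symbols with which `d`-dimensional patterns over `A` are written on a tape. A word is read
from left to right by a pointer which starts at the origin of `ℤ^d`. The symbol `letter a` says
that the pattern has the letter `a` at the position of the pointer, and moves the pointer by the
first basis vector; `forward i` and `backward i` move it by plus or minus the `i`-th basis
vector. For `d = 1` a word of letters is the usual word with support `[0, ℓ - 1]`. -/
inductive PatternSymbol (d : ℕ) (A : Type*)
  | letter (a : A)
  | forward (i : Fin d)
  | backward (i : Fin d)

/-- The pairs (position, letter) which a word describes, when it is read from position `v`. -/
def readWord {d : ℕ} [NeZero d] {A : Type*} :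
    IntLattice d → List (PatternSymbol d A) → List (IntLattice d × A)
  | _, [] => []
  | v, .letter a :: w => (v, a) :: readWord (v + Pi.single 0 1) w
  | v, .forward i :: w => readWord (v + Pi.single i 1) w
  | v, .backward i :: w => readWord (v - Pi.single i 1) w

/-- The word `w` describes the pattern `p`. -/
def Codes {d : ℕ} [NeZero d] {A : Type*} (w : List (PatternSymbol d A)) (p : Pattern d A) : Prop :=
  ∀ (v : IntLattice d) (a : A), (v, a) ∈ readWord 0 w ↔ ∃ h : v ∈ p.support, p.val ⟨v, h⟩ = a

/-- A Turing machine whose tape alphabet contains the symbols for writing `d`-dimensional patterns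
over `A` and a separator `$`, all distinct and different from the blank symbol. -/
structure PatternMachine (d : ℕ) (A : Type*) (k : ℕ) (Q Γ : Type*) extends
    TuringMachine k Q Γ where
  symbol : PatternSymbol d A → Γ
  separator : Γ
  symbol_injective : Function.Injective symbol
  symbol_ne_blank : ∀ s, symbol s ≠ blank
  symbol_ne_separator : ∀ s, symbol s ≠ separator
  separator_ne_blank : separator ≠ blank

/-- After `t` steps the word `w` is entirely written on the first tape: this tape contains
`$ w $`. -/
def PatternMachine.HasWritten {d : ℕ} {A : Type*} {k : ℕ} [NeZero k] {Q Γ : Type*}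
    (M : PatternMachine d A k Q Γ) (t : ℕ) (w : List (PatternSymbol d A)) : Prop :=
  ∃ i : ℤ, (M.run t).tape 0 i = M.separator ∧
    (∀ (j : ℕ) (hj : j < w.length), (M.run t).tape 0 (i + 1 + j) = M.symbol w[j]) ∧
    (M.run t).tape 0 (i + 1 + w.length) = M.separator

/-- The set of patterns which `M` has enumerated after `t` steps. -/
def PatternMachine.generated {d : ℕ} [NeZero d] {A : Type*} {k : ℕ} [NeZero k] {Q Γ : Type*}
    (M : PatternMachine d A k Q Γ) (t : ℕ) : Set (Pattern d A) :=
  {p | ∃ w, M.HasWritten t w ∧ Codes w p}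

/-- `M` is an enumerative Turing machine of `F`: started on empty tapes, it successively writes the
patterns of `F`, and nothing else, on its first tape, between separators. What has been written on
this tape stays there. -/
structure PatternMachine.Enumerates {d : ℕ} [NeZero d] {A : Type*} {k : ℕ} [NeZero k]
    {Q Γ : Type*} (M : PatternMachine d A k Q Γ) (F : Set (Pattern d A)) : Prop where
  permanent : ∀ (t : ℕ) (i : ℤ), (M.run t).tape 0 i ≠ M.blank →
    (M.run (t + 1)).tape 0 i = (M.run t).tape 0 i
  sound : ∀ (t : ℕ) (w : List (PatternSymbol d A)), M.HasWritten t w → ∃ p ∈ F, Codes w p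
  complete : ∀ p ∈ F, ∃ t, p ∈ M.generated t

/-- The enumeration time `Dtime^enu_M (k)`: the least `t` such that the patterns generated after `t`
steps forbid all patterns of support `[0, k - 1]^d` that are not in the language of `𝐓_F`. (By
compactness such a `t` exists if `M` enumerates `F` and `A` is finite.) -/
noncomputable def PatternMachine.enumTime {d : ℕ} [NeZero d] {A : Type*} {k : ℕ} [NeZero k]
    {Q Γ : Type*} (M : PatternMachine d A k Q Γ) (F : Set (Pattern d A)) (n : ℕ) : ℕ :=
  sInf {t : ℕ | ∀ u : Pattern d A, u.support = cube d n →
    u ∉ language (subshift F) → u ∉ language (subshift (M.generated t))}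

/-! The additional dimension serves as time. An `init` row carries a candidate configuration `x`,
which is copied upwards unchanged, and the rows above it simulate `M` and look for the generated
patterns in `x`.

The tapes are laid along the first coordinate, and each row is cut into zones of width `2 * T` with
`T = 2 ^ l`. All zones run the same computation in lockstep, so the state and the symbols under the
heads can be information that is constant along the row. In phase `l` the machine restarts on empty
tapes and makes `T` steps, too few to disturb the neighbouring zones. A scanner, moving one cell per
row, measures this time and then sweeps the first tape. Meanwhile a second copy of `x` is shifted
along with the pointer of the word being read, so all cells `z` test in parallel whether the pattern
described since the last separator appears in `x` at `z`. A cell that still agrees at the next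
separator violates the rule. Afterwards the zones are merged in pairs and phase `l + 1` begins.

The lengths of the phases grow geometrically, so the patterns generated in `t` steps are excluded
after `O(t)` rows (`PatternMachine.Enumerates.mem_subshift_of_rule`). Conversely, `n` rows cannot
simulate more than `n` steps, so every `x` avoiding the patterns generated in `n` steps extends to
the strip (`PatternMachine.Enumerates.evolution_rule`). These two inclusions yield both the
subaction and the comparison of speeds (`speedEquiv_of_subset`).

No local rule can force row `0` to be the `init` row. Any other row outputs a translate of the
periodic point, produced from coordinates modulo `N`, and this is harmless because it lies in the
subshift. The full shift is treated apart, since there both speeds must vanish. -/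

/-! ### Subshifts of finite type given by a local rule -/

/-- The finite set of the offsets which a local rule inspects. -/
noncomputable def window {m : ℕ} {ι : Type*} [Finite ι] (off : ι → IntLattice m) :
    Finset (IntLattice m) :=
  (Set.finite_range off).toFinset

theorem mem_window {m : ℕ} {ι : Type*} [Finite ι] (off : ι → IntLattice m) (δ : ι) :
    off δ ∈ window off := by
  simp [window]

/-- The patterns on the window of the offsets which violate a local rule. -/
def localPatterns {m : ℕ} {ι B : Type*} [Finite ι] (off : ι → IntLattice m)
    (rule : (ι → B) → Prop) : Set (Pattern m B) :=
  (fun f : window off → B => (⟨window off, f⟩ : Pattern m B)) ''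
    {f | ¬ rule fun δ => f ⟨off δ, mem_window off δ⟩}

theorem finite_localPatterns {m : ℕ} {ι B : Type*} [Finite ι] [Finite B]
    (off : ι → IntLattice m) (rule : (ι → B) → Prop) : (localPatterns off rule).Finite :=
  (Set.toFinite _).image _

theorem mem_approxRow_localPatterns {d : ℕ} {ι B : Type*} [Finite ι]
    (off : ι → IntLattice (d + 1)) (rule : (ι → B) → Prop) (n : ℕ)
    (x : IntLattice (d + 1) → B) :
    x ∈ approxRow (localPatterns off rule) n ↔
      ∀ i, (∀ δ, i + off δ ∈ strip d n) → rule fun δ => x (i + off δ) := by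
  constructor
  · intro hx i hi
    by_contra hr
    refine hx ⟨window off, fun u => x (i + u)⟩ ⟨_, hr, rfl⟩ i ?_ fun u => rfl
    rintro ⟨u, hu⟩
    obtain ⟨δ, rfl⟩ := (Set.Finite.mem_toFinset _).1 hu
    exact hi δ
  · rintro hx _ ⟨f, hf, rfl⟩ i hi h
    apply hf
    have := hx i fun δ => hi ⟨off δ, mem_window off δ⟩
    convert this using 2 with δ
    exact (h ⟨off δ, mem_window off δ⟩).symm

theorem mem_subshift_localPatterns {m : ℕ} {ι B : Type*} [Finite ι]
    (off : ι → IntLattice m) (rule : (ι → B) → Prop) (x : IntLattice m → B) :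
    x ∈ subshift (localPatterns off rule) ↔ ∀ i, rule fun δ => x (i + off δ) := by
  constructor
  · intro hx i
    by_contra hr
    exact hx ⟨window off, fun u => x (i + u)⟩ ⟨_, hr, rfl⟩ ⟨i, fun u => rfl⟩
  · rintro hx _ ⟨f, hf, rfl⟩ ⟨i, h⟩
    apply hf
    convert hx i using 2 with δ
    exact (h ⟨off δ, mem_window off δ⟩).symm

/-- A local rule over a finite set of labels in any universe, together with a letter-to-letter
output map, is realized by a finite set of patterns over an alphabet in `Type` and a factor map. -/
theorem exists_sft_of_rule {d : ℕ} {ι L A : Type*} [Finite ι] [Finite L]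
    (off : ι → IntLattice (d + 1)) (rule : (ι → L) → Prop) (out : L → A) :
    ∃ (B : Type) (_ : Finite B) (G : Set (Pattern (d + 1) B)) (_ : G.Finite)
      (π : FactorMap (d + 1) B A),
      ((fun x => subaction (π.apply x)) '' subshift G =
        {x | ∃ Y : IntLattice (d + 1) → L, (∀ i, rule fun δ => Y (i + off δ)) ∧
          x = fun z => out (Y (Fin.snoc (α := fun _ => ℤ) z 0))}) ∧
      (∀ n : ℕ, (fun x => subaction (π.apply x)) '' approxRow G n =
        {x | ∃ Y : IntLattice (d + 1) → L,
          (∀ i, (∀ δ, i + off δ ∈ strip d n) → rule fun δ => Y (i + off δ)) ∧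
          x = fun z => out (Y (Fin.snoc (α := fun _ => ℤ) z 0))}) ∧
      ∀ n : ℕ, (∀ u ∈ π.neighborhood, u ∈ strip d n) ↔ 1 ≤ n := by
  let e := Finite.equivFin L
  -- The rule ignores the second offset, which only restricts the admissible strips to `1 ≤ n`.
  let π : FactorMap (d + 1) (Fin (Nat.card L)) A :=
    { neighborhood := {0, Pi.single (Fin.last d) 1}
      rule := fun f => out (e.symm (f ⟨0, by simp⟩)) }
  have hπ : ∀ Y : IntLattice (d + 1) → Fin (Nat.card L),
      subaction (π.apply Y) = fun z => out (e.symm (Y (Fin.snoc (α := fun _ => ℤ) z 0))) := by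
    intro Y
    funext z
    simp [subaction, FactorMap.apply, π]
  let r : (ι → Fin (Nat.card L)) → Prop := fun f => rule fun δ => e.symm (f δ)
  refine ⟨Fin (Nat.card L), inferInstance, localPatterns off r, finite_localPatterns off r, π,
    ?_, fun n => ?_, fun n => ?_⟩
  · ext x
    constructor
    · rintro ⟨Y, hY, rfl⟩
      rw [mem_subshift_localPatterns] at hY
      exact ⟨fun i => e.symm (Y i), hY, hπ Y⟩
    · rintro ⟨Y, hY, rfl⟩
      refine ⟨fun i => e (Y i), ?_, ?_⟩
      · rw [mem_subshift_localPatterns]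
        simpa [r] using hY
      · simp [hπ]
  · ext x
    constructor
    · rintro ⟨Y, hY, rfl⟩
      rw [mem_approxRow_localPatterns] at hY
      exact ⟨fun i => e.symm (Y i), hY, hπ Y⟩
    · rintro ⟨Y, hY, rfl⟩
      refine ⟨fun i => e (Y i), ?_, ?_⟩
      · rw [mem_approxRow_localPatterns]
        simpa [r] using hY
      · simp [hπ]
  · simp only [π, Finset.mem_insert, Finset.mem_singleton, forall_eq_or_imp, forall_eq, strip,
      Set.mem_ofPred_eq, Pi.zero_apply, Pi.single_eq_same]
    omega

/-! ### Languages of cubes -/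

theorem mem_subshift_translate {d : ℕ} {A : Type*} {F : Set (Pattern d A)}
    {x : IntLattice d → A} (hx : x ∈ subshift F) (v : IntLattice d) :
    (fun i => x (i + v)) ∈ subshift F := by
  rintro p hp ⟨i, hi⟩
  refine hx p hp ⟨i + v, fun u => ?_⟩
  rw [← hi u]
  congr 1
  abel

theorem cube_subset_cube {d k K : ℕ} (h : k ≤ K) : cube d k ⊆ cube d K := by
  intro v
  simp only [cube, Fintype.mem_piFinset, Finset.mem_Ico]
  intro hv i
  have := hv i
  omega

/-- If the words of a larger cube which are not in the language of `S` are not in the language of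
`X`, then so it is for a smaller cube. -/
theorem cube_language_mono {d : ℕ} {A : Type*} {S X : Set (IntLattice d → A)} {k K : ℕ}
    (hkK : k ≤ K)
    (h : ∀ u : Pattern d A, u.support = cube d K → u ∉ language S → u ∉ language X)
    (u : Pattern d A) (hu : u.support = cube d k) (huS : u ∉ language S) : u ∉ language X := by
  rintro ⟨x, hx, i, hi⟩
  have hX : (⟨cube d K, fun v => x (i + v)⟩ : Pattern d A) ∈ language X :=
    ⟨x, hx, i, fun _ => rfl⟩
  obtain ⟨y, hy, j, hj⟩ := not_not.1 fun hn => h _ rfl hn hX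
  refine huS ⟨y, hy, j, fun v => ?_⟩
  rw [← hi v]
  exact hj ⟨v, cube_subset_cube hkK (hu ▸ v.2)⟩

/-- A finite set of positions lies in a translate of all large cubes. -/
theorem exists_translate_subset_cube {d : ℕ} (U : Finset (IntLattice d)) :
    ∃ (r : ℕ) (v : IntLattice d), ∀ k, r ≤ k → ∀ u ∈ U, v + u ∈ cube d k := by
  classical
  let b : ℕ := U.sup fun u => Finset.univ.sup fun i => (u i).natAbs
  have hb : ∀ u ∈ U, ∀ i, (u i).natAbs ≤ b := fun u hu i =>
    (Finset.le_sup (f := fun i => (u i).natAbs) (Finset.mem_univ i)).trans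
      (Finset.le_sup (f := fun u : IntLattice d => Finset.univ.sup fun i => (u i).natAbs) hu)
  refine ⟨2 * b + 1, fun _ => b, fun k hk u hu => ?_⟩
  simp only [cube, Fintype.mem_piFinset, Finset.mem_Ico, Pi.add_apply]
  intro i
  have := hb u hu i
  omega

theorem Pattern.isOpen_appearsIn {d : ℕ} {A : Type*} [TopologicalSpace A] [DiscreteTopology A]
    (p : Pattern d A) : IsOpen {x : IntLattice d → A | p.AppearsIn x} := by
  have : {x : IntLattice d → A | p.AppearsIn x} =
      ⋃ i : IntLattice d, ⋂ u : p.support, (fun x => x (i + u)) ⁻¹' {p.val u} := by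
    ext x
    simp [Pattern.AppearsIn]
  rw [this]
  exact isOpen_iUnion fun i => isOpen_iInter_of_finite fun u =>
    (isOpen_discrete _).preimage (continuous_apply _)

/-- Compactness: if the increasing union of the sets `E t` of patterns has the same subshift as
`F`, then for every finite support some `E t` forbids all that `F` forbids. -/
theorem exists_forbids {d : ℕ} {A : Type*} [Finite A] {F : Set (Pattern d A)}
    (E : ℕ → Set (Pattern d A)) (hmono : Monotone E)
    (hE : ∀ x, (∀ t, x ∈ subshift (E t)) → x ∈ subshift F) (U : Finset (IntLattice d)) :
    ∃ t, ∀ u : Pattern d A, u.support = U → u ∉ language (subshift F) →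
      u ∉ language (subshift (E t)) := by
  let _ : TopologicalSpace A := ⊥
  have : DiscreteTopology A := ⟨rfl⟩
  have hsub : ∀ {s t}, s ≤ t → subshift (E t) ⊆ subshift (E s) :=
    fun hst x hx p hp => hx p (hmono hst hp)
  have key : ∀ f : U → A, ∃ t, (⟨U, f⟩ : Pattern d A) ∉ language (subshift F) →
      (⟨U, f⟩ : Pattern d A) ∉ language (subshift (E t)) := by
    intro f
    by_contra! hcon
    have hF := (hcon 0).1
    -- If `f` survived every `E t`, these would be decreasing nonempty compact sets, and a common
    -- point would put `f` in the language of `subshift F`.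
    let K : ℕ → Set (IntLattice d → A) := fun t =>
      subshift (E t) ∩ {x | ∀ u : U, x u = f u}
    have hclosed : ∀ t, IsClosed (K t) := by
      intro t
      refine IsClosed.inter ?_ ?_
      · have : subshift (E t) = ⋂ p ∈ E t, {x : IntLattice d → A | p.AppearsIn x}ᶜ := by
          ext x
          simp [subshift]
        rw [this]
        exact isClosed_biInter fun p _ => (Pattern.isOpen_appearsIn p).isClosed_compl
      · have : {x : IntLattice d → A | ∀ u : U, x u = f u} =
            ⋂ u : U, (fun x => x u) ⁻¹' {f u} := by
          ext x
          simp
        rw [this]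
        exact isClosed_iInter fun u => (isClosed_discrete _).preimage (continuous_apply _)
    have hne : ∀ t, (K t).Nonempty := by
      intro t
      obtain ⟨x, hx, i, hi⟩ := (hcon t).2
      refine ⟨fun v => x (v + i), mem_subshift_translate hx i, fun u => ?_⟩
      exact (congrArg x (add_comm _ _)).trans (hi u)
    obtain ⟨x, hx⟩ := IsCompact.nonempty_iInter_of_sequence_nonempty_isCompact_isClosed K
      (fun t => Set.inter_subset_inter_left _ (hsub (Nat.le_succ t))) hne
      (hclosed 0).isCompact hclosed
    rw [Set.mem_iInter] at hx
    exact hF ⟨x, hE x fun t => (hx t).1, 0, fun u => by simpa using (hx 0).2 u⟩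
  choose t ht using key
  have := Fintype.ofFinite (U → A)
  refine ⟨Finset.univ.sup t, ?_⟩
  rintro ⟨_, f⟩ rfl hu ⟨x, hx, hux⟩
  exact ht f hu ⟨x, hsub (Finset.le_sup (Finset.mem_univ f)) hx, hux⟩

/-! ### Enumerated patterns -/

section Enumeration

variable {d : ℕ} [NeZero d] {A : Type*} {k : ℕ} [NeZero k] {Q Γ : Type*}
  {M : PatternMachine d A k Q Γ} {F : Set (Pattern d A)}

theorem Codes.forall_iff {w : List (PatternSymbol d A)} {p : Pattern d A} (h : Codes w p)
    (x : IntLattice d → A) (i : IntLattice d) :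
    (∀ u : p.support, x (i + u) = p.val u) ↔ ∀ q ∈ readWord 0 w, x (i + q.1) = q.2 := by
  constructor
  · rintro hx ⟨v, a⟩ hva
    obtain ⟨hv, rfl⟩ := (h v a).1 hva
    exact hx ⟨v, hv⟩
  · intro hx u
    exact hx (u, p.val u) ((h u (p.val u)).2 ⟨u.2, rfl⟩)

theorem PatternMachine.Enumerates.tape_eq (hM : M.Enumerates F) {s t : ℕ} (hst : s ≤ t) {i : ℤ}
    (h : (M.run s).tape 0 i ≠ M.blank) : (M.run t).tape 0 i = (M.run s).tape 0 i := by
  induction t, hst using Nat.le_induction with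
  | base => rfl
  | succ t _ ih => rw [hM.permanent t i (ih ▸ h), ih]

theorem PatternMachine.Enumerates.hasWritten_mono (hM : M.Enumerates F) {s t : ℕ} (hst : s ≤ t)
    {w : List (PatternSymbol d A)} (h : M.HasWritten s w) : M.HasWritten t w := by
  obtain ⟨i, h1, h2, h3⟩ := h
  refine ⟨i, ?_, fun j hj => ?_, ?_⟩
  · rw [hM.tape_eq hst (h1 ▸ M.separator_ne_blank), h1]
  · rw [hM.tape_eq hst (h2 j hj ▸ M.symbol_ne_blank _), h2 j hj]
  · rw [hM.tape_eq hst (h3 ▸ M.separator_ne_blank), h3]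

theorem PatternMachine.Enumerates.generated_mono (hM : M.Enumerates F) :
    Monotone M.generated := by
  rintro s t hst p ⟨w, hw, hp⟩
  exact ⟨w, hM.hasWritten_mono hst hw, hp⟩

/-- Soundness gives a pattern of `F` with the same word, and two patterns described by one word
appear at the same places. -/
theorem PatternMachine.Enumerates.subshift_subset (hM : M.Enumerates F) (t : ℕ) :
    subshift F ⊆ subshift (M.generated t) := by
  rintro x hx p ⟨w, hw, hp⟩ ⟨i, hi⟩
  obtain ⟨q, hq, hwq⟩ := hM.sound t w hw
  exact hx q hq ⟨i, (hwq.forall_iff x i).2 ((hp.forall_iff x i).1 hi)⟩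

theorem PatternMachine.Enumerates.mem_subshift (hM : M.Enumerates F) {x : IntLattice d → A}
    (hx : ∀ t, x ∈ subshift (M.generated t)) : x ∈ subshift F := by
  intro p hp
  obtain ⟨t, ht⟩ := hM.complete p hp
  exact hx t p ht

theorem PatternMachine.generated_zero : M.generated 0 = ∅ := by
  refine Set.eq_empty_of_forall_notMem ?_
  rintro p ⟨w, ⟨i, h, -⟩, -⟩
  exact M.separator_ne_blank h.symm

theorem PatternMachine.Enumerates.enumTime_spec [Finite A] (hM : M.Enumerates F) (n : ℕ) :
    ∀ u : Pattern d A, u.support = cube d n →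
      u ∉ language (subshift F) → u ∉ language (subshift (M.generated (M.enumTime F n))) :=
  Nat.sInf_mem (s := {t : ℕ | ∀ u : Pattern d A, u.support = cube d n →
    u ∉ language (subshift F) → u ∉ language (subshift (M.generated t))})
    (exists_forbids M.generated hM.generated_mono (fun _ => hM.mem_subshift) (cube d n))

/-- If the subshift is not the full shift, the enumeration time of large cubes is positive. -/
theorem PatternMachine.Enumerates.enumTime_pos [Finite A] (hM : M.Enumerates F)
    (hF : subshift F ≠ Set.univ) : ∃ r, ∀ n, r ≤ n → 1 ≤ M.enumTime F n := by
  obtain ⟨x, hx⟩ := (Set.ne_univ_iff_exists_notMem _).1 hF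
  simp only [subshift, Set.mem_ofPred_eq, not_forall, not_not] at hx
  obtain ⟨p, hp, i, hi⟩ := hx
  obtain ⟨r, v, hv⟩ := exists_translate_subset_cube p.support
  refine ⟨r, fun n hn => Nat.one_le_iff_ne_zero.2 fun h0 => ?_⟩
  have hs := hM.enumTime_spec n
  rw [h0, PatternMachine.generated_zero] at hs
  -- This cube contains `p`, placed at `v`, so it is not in the language of `subshift F`, whereas
  -- nothing is forbidden at time `0`.
  refine hs ⟨cube d n, fun u => x (i - v + u)⟩ rfl ?_ ⟨x, ?_, i - v, fun _ => rfl⟩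
  · rintro ⟨y, hy, j, hj⟩
    refine hy p hp ⟨j + v, fun u => ?_⟩
    have h1 := hj ⟨v + u, hv n hn u u.2⟩
    rw [← hi u, add_assoc]
    refine h1.trans (congrArg x ?_)
    simp only
    abel
  · simp [subshift]

/-- The comparison of the speeds: it suffices to compare the approximating sets. -/
theorem speedEquiv_of_subset [Finite A] (hM : M.Enumerates F) (hF : subshift F ≠ Set.univ)
    {B : Type} {G : Set (Pattern (d + 1) B)} {π : FactorMap (d + 1) B A} {C : ℕ}
    (hC : 1 ≤ C)
    (hG : (fun x => subaction (π.apply x)) '' subshift G = subshift F)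
    (hπ : ∀ n : ℕ, (∀ u ∈ π.neighborhood, u ∈ strip d n) ↔ 1 ≤ n)
    (hle : ∀ t : ℕ, 1 ≤ t →
      (fun x => subaction (π.apply x)) '' approxRow G (C * t) ⊆ subshift (M.generated t))
    (hge : ∀ n : ℕ, subshift (M.generated n) ⊆ (fun x => subaction (π.apply x)) '' approxRow G n) :
    SpeedEquiv (convergenceSpeed G π) (M.enumTime F) := by
  obtain ⟨r, hr⟩ := hM.enumTime_pos hF
  have lang_mono : ∀ {X Y : Set (IntLattice d → A)}, X ⊆ Y → language X ⊆ language Y :=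
    fun h p ⟨x, hx, hp⟩ => ⟨x, h hx, hp⟩
  have mem : ∀ n, C * M.enumTime F (n + r) ∈ {m : ℕ | (∀ u ∈ π.neighborhood, u ∈ strip d m) ∧
      ∀ u : Pattern d A, u.support = cube d n →
      u ∉ language ((fun x => subaction (π.apply x)) '' subshift G) →
      u ∉ language ((fun x => subaction (π.apply x)) '' approxRow G m)} := by
    intro n
    -- The shift by `r` makes the enumeration time positive, as `hle` and the strip condition
    -- require.
    have h1 := hr (n + r) (by omega)
    refine ⟨(hπ _).2 (Nat.mul_pos hC h1), fun u hu huS hX => ?_⟩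
    rw [hG] at huS
    exact cube_language_mono (Nat.le_add_right n r) (hM.enumTime_spec (n + r)) u hu huS
      (lang_mono (hle _ h1) hX)
  refine ⟨⟨r, C, fun n => Nat.sInf_le (mem n)⟩, 0, 1, fun n => ?_⟩
  rw [one_mul, add_zero]
  refine Nat.sInf_le fun u hu huF hX => ?_
  refine (Nat.sInf_mem ⟨_, mem n⟩).2 u hu (by rwa [hG]) (lang_mono (hge _) hX)

end Enumeration

/-- The full shift is realized by the empty set of patterns. -/
theorem exists_sft_of_subshift_eq_univ {d : ℕ} [NeZero d] {A : Type*} [Finite A]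
    {F : Set (Pattern d A)} (hF : subshift F = Set.univ) {k : ℕ} [NeZero k] {Q Γ : Type*}
    (M : PatternMachine d A k Q Γ) :
    ∃ (B : Type) (_ : Finite B) (G : Set (Pattern (d + 1) B)) (_ : G.Finite)
      (π : FactorMap (d + 1) B A),
      (fun x => subaction (π.apply x)) '' subshift G = subshift F ∧
      SpeedEquiv (convergenceSpeed G π) (M.enumTime F) := by
  let e := Finite.equivFin A
  -- With only the origin as neighbourhood the strip `n = 0` is admissible, so the convergence speed
  -- is `0` like the enumeration time.
  let π : FactorMap (d + 1) (Fin (Nat.card A)) A :=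
    { neighborhood := {0}
      rule := fun f => e.symm (f ⟨0, by simp⟩) }
  have hsub : (fun x => subaction (π.apply x)) '' subshift ∅ = Set.univ := by
    refine Set.eq_univ_of_forall fun x => ⟨fun z => e (x (Fin.init z)), by simp [subshift], ?_⟩
    funext z
    simp [subaction, FactorMap.apply, π]
  have lang_mono : ∀ {X : Set (IntLattice d → A)} {u : Pattern d A},
      u ∉ language (Set.univ : Set (IntLattice d → A)) → u ∉ language X :=
    fun hu ⟨x, _, hux⟩ => hu ⟨x, trivial, hux⟩
  have h1 : ∀ n, convergenceSpeed ∅ π n = 0 := fun n => Nat.eq_zero_of_le_zero <|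
    Nat.sInf_le ⟨by simp [π, strip], fun u _ h => lang_mono (by rwa [hsub] at h)⟩
  have h2 : ∀ n, M.enumTime F n = 0 := fun n => Nat.eq_zero_of_le_zero <|
    Nat.sInf_le fun u _ h => lang_mono (by rwa [hF] at h)
  exact ⟨_, inferInstance, ∅, Set.finite_empty, π, hsub.trans hF.symm,
    ⟨0, 0, fun n => by simp [h1]⟩, 0, 0, fun n => by simp [h2]⟩

/-! ### Scanning a word while the configuration moves -/

section Scan

variable {d : ℕ} [NeZero d] {A : Type*} {k : ℕ} {Q Γ : Type*}

/-- The position of the pointer after reading a word. -/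
def pointer : IntLattice d → List (PatternSymbol d A) → IntLattice d
  | v, [] => v
  | v, .letter _ :: w => pointer (v + Pi.single 0 1) w
  | v, .forward i :: w => pointer (v + Pi.single i 1) w
  | v, .backward i :: w => pointer (v - Pi.single i 1) w

theorem readWord_append (v : IntLattice d) (w w' : List (PatternSymbol d A)) :
    readWord v (w ++ w') = readWord v w ++ readWord (pointer v w) w' := by
  induction w generalizing v with
  | nil => rfl
  | cons s w ih => cases s <;> simp [readWord, pointer, ih]

theorem pointer_append (v : IntLattice d) (w w' : List (PatternSymbol d A)) :
    pointer v (w ++ w') = pointer (pointer v w) w' := by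
  induction w generalizing v with
  | nil => rfl
  | cons s w ih => cases s <;> simp [pointer, ih]

variable (M : PatternMachine d A k Q Γ)

/-- The pattern symbol which a tape symbol represents. -/
noncomputable def PatternMachine.decode (γ : Γ) : Option (PatternSymbol d A) :=
  Function.partialInv M.symbol γ

omit [NeZero d] in
theorem PatternMachine.decode_symbol (s : PatternSymbol d A) : M.decode (M.symbol s) = some s :=
  Function.partialInv_left M.symbol_injective s

omit [NeZero d] in
theorem PatternMachine.symbol_of_decode {γ : Γ} {s : PatternSymbol d A}
    (h : M.decode γ = some s) : M.symbol s = γ :=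
  (M.symbol_injective.isPartialInv s γ).1 h

open Classical in
/-- The new letter of the moving copy at a cell, when the tape symbol `γ` is read: `x` is the
letter of the fixed copy, `r` and `l` are the letters of the moving copy at the neighbours. -/
noncomputable def PatternMachine.scanLetter (γ : Γ) (x : A) (r l : Fin d → A) : A :=
  if γ = M.separator then x else
    match M.decode γ with
    | some (.letter _) => r 0
    | some (.forward i) => r i
    | some (.backward i) => l i
    | none => x

/-- Whether a cell agrees with the word read so far, after the tape symbol `γ` is read. -/
def PatternMachine.scanAgrees (γ : Γ) (y : A) (p : Prop) : Prop :=
  γ = M.separator ∨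
    match M.decode γ with
    | some (.letter a) => p ∧ y = a
    | some (.forward _) => p
    | some (.backward _) => p
    | none => False

/-- The moving copy of `x` and the set of the agreeing cells after the first `n` symbols of `σ`
have been read. -/
noncomputable def PatternMachine.scanned (M : PatternMachine d A k Q Γ) (σ : ℕ → Γ)
    (x : IntLattice d → A) : ℕ → (IntLattice d → A) × (IntLattice d → Prop)
  | 0 => (x, fun _ => False)
  | n + 1 =>
    let c := M.scanned σ x n
    (fun z => M.scanLetter (σ n) (x z) (fun i => c.1 (z + Pi.single i 1))
      fun i => c.1 (z - Pi.single i 1),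
      fun z => M.scanAgrees (σ n) (c.1 z) (c.2 z))

variable {M} {σ : ℕ → Γ} {x : IntLattice d → A}

/-- A separator resets the moving copy and makes every cell agree. Each later symbol shifts the copy
by the step of the pointer, so cell `z` holds the letter of `x` at `z` plus the pointer and compares
it locally. -/
theorem PatternMachine.scanned_of_word {a : ℕ} (ha : σ a = M.separator)
    (w : List (PatternSymbol d A))
    (hw : ∀ (j : ℕ) (hj : j < w.length), σ (a + 1 + j) = M.symbol w[j]) :
    (M.scanned σ x (a + 1 + w.length)).1 = (fun z => x (z + pointer 0 w)) ∧
      ∀ z, (M.scanned σ x (a + 1 + w.length)).2 z ↔ ∀ q ∈ readWord 0 w, x (z + q.1) = q.2 := by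
  induction w using List.reverseRecOn with
  | nil => simp [PatternMachine.scanned, PatternMachine.scanLetter, PatternMachine.scanAgrees, ha,
      pointer, readWord]
  | append_singleton w s ih =>
    have hlt : w.length < (w ++ [s]).length := by simp
    have hs : σ (a + 1 + w.length) = M.symbol s := by simpa using hw w.length hlt
    obtain ⟨h1, h2⟩ := ih fun j hj => by
      rw [hw j (hj.trans hlt), List.getElem_append_left hj]
    rw [List.length_append, List.length_singleton, ← add_assoc]
    simp only [PatternMachine.scanned, PatternMachine.scanLetter, PatternMachine.scanAgrees, hs,
      M.symbol_ne_separator, if_false, false_or, M.decode_symbol, h1, h2, pointer_append,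
      readWord_append]
    cases s <;> simp [pointer, readWord, or_imp, forall_and, add_assoc, add_comm,
      sub_eq_add_neg]

/-- Agreement starts only at a separator and survives only pattern symbols. -/
theorem PatternMachine.exists_word_of_scanned {n : ℕ} {z : IntLattice d}
    (h : (M.scanned σ x n).2 z) :
    ∃ (a : ℕ) (w : List (PatternSymbol d A)), a + 1 + w.length = n ∧ σ a = M.separator ∧
      ∀ (j : ℕ) (hj : j < w.length), σ (a + 1 + j) = M.symbol w[j] := by
  induction n with
  | zero => exact h.elim
  | succ n ih =>
    rcases h with h | h
    · exact ⟨n, [], by simp, h, by simp⟩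
    · have key : ∀ s, M.decode (σ n) = some s → (M.scanned σ x n).2 z →
          ∃ (a : ℕ) (w : List (PatternSymbol d A)), a + 1 + w.length = n + 1 ∧
            σ a = M.separator ∧
            ∀ (j : ℕ) (hj : j < w.length), σ (a + 1 + j) = M.symbol w[j] := by
        intro s hs hz
        obtain ⟨a, w, hn, ha, hw⟩ := ih hz
        refine ⟨a, w ++ [s], by simp; omega, ha, fun j hj => ?_⟩
        rcases Nat.lt_or_ge j w.length with hjw | hjw
        · rw [hw j hjw, List.getElem_append_left hjw]
        · have : j = w.length := by simp at hj; omega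
          subst this
          simpa [hn] using (M.symbol_of_decode hs).symm
      split at h
      · exact key _ ‹_› h.1
      · exact key _ ‹_› h
      · exact key _ ‹_› h
      · exact h.elim

end Scan

/-! ### The labels and the local rule -/

/-- The control of a row: below the initial row, in the initial row, while the machine runs, and
while its first tape is scanned. -/
inductive Control (Q : Type*)
  | idle
  | init
  | run (q : Q)
  | scan

/-- The information which is constant along a row: the control, the symbols read by the heads of
the machine, the symbol read by the scanning head, and whether the latter is at a middle. -/
@[ext] structure RowInfo (k : ℕ) (Q Γ : Type*) where
  control : Control Q
  read : Fin k → Γ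
  scan : Γ
  atMiddle : Prop

/-- The information which depends on the first coordinate only: tape symbols, heads, the scanning
head, and the marks which delimit the zones and their middles. -/
@[ext] structure CellInfo (k : ℕ) (Γ : Type*) where
  tape : Fin k → Γ
  head : Fin k → Prop
  scanner : Prop
  mark : Prop
  middle : Prop

/-- The labels of the subshift of finite type. -/
structure Label (d N : ℕ) (A : Type*) (k : ℕ) (Q Γ : Type*) where
  phase : Fin d → ZMod N
  row : RowInfo k Q Γ
  cell : CellInfo k Γ
  bit : Prop
  fixed : A
  moving : A
  agrees : Prop

instance {Q : Type*} [Finite Q] : Finite (Control Q) :=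
  Finite.of_injective
    (fun c : Control Q => (match c with
      | .idle => none
      | .init => some none
      | .run q => some (some (some q))
      | .scan => some (some none) : Option (Option (Option Q))))
    (by rintro (_ | _ | _ | _) (_ | _ | _ | _) h <;> simp_all)

instance {k : ℕ} {Q Γ : Type*} [Finite Q] [Finite Γ] : Finite (RowInfo k Q Γ) :=
  Finite.of_injective (fun g => (g.control, g.read, g.scan, g.atMiddle)) <| by
    rintro ⟨⟩ ⟨⟩ h
    simp_all

instance {k : ℕ} {Γ : Type*} [Finite Γ] : Finite (CellInfo k Γ) :=
  Finite.of_injective (fun c => (c.tape, c.head, c.scanner, c.mark, c.middle)) <| by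
    rintro ⟨⟩ ⟨⟩ h
    simp_all

instance {d N : ℕ} [NeZero N] {A : Type*} {k : ℕ} {Q Γ : Type*} [Finite A] [Finite Q] [Finite Γ] :
    Finite (Label d N A k Q Γ) :=
  Finite.of_injective
    (fun c => (c.phase, c.row, c.cell, c.bit, c.fixed, c.moving, c.agrees)) <| by
    rintro ⟨⟩ ⟨⟩ h
    simp_all

/-- The neighbours which the local rule inspects. -/
inductive Neighbor (d : ℕ)
  | center
  | up
  | plus (i : Fin d)
  | minus (i : Fin d)

instance {d : ℕ} : Finite (Neighbor d) :=
  Finite.of_injective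
    (fun c : Neighbor d => (match c with
      | .center => none
      | .up => some none
      | .plus i => some (some (.inl i))
      | .minus i => some (some (.inr i)) : Option (Option (Fin d ⊕ Fin d))))
    (by rintro (_ | _ | _ | _) (_ | _ | _ | _) h <;> simp_all)

/-- The displacement of a neighbour. -/
def Neighbor.offset {d : ℕ} : Neighbor d → IntLattice (d + 1)
  | .center => 0
  | .up => Fin.snoc (α := fun _ => ℤ) 0 1
  | .plus i => Fin.snoc (α := fun _ => ℤ) (Pi.single i 1) 0
  | .minus i => Fin.snoc (α := fun _ => ℤ) (-Pi.single i 1) 0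

section Rule

variable {d : ℕ} [NeZero d] {A : Type*} {k : ℕ} {Q Γ : Type*}

open Classical in
/-- The transition function, extended so that a machine in a final state does nothing. -/
noncomputable def TuringMachine.act (M : TuringMachine k Q Γ) (q : Q) (γ : Fin k → Γ) :
    Q × (Fin k → Γ) × (Fin k → HeadMove) :=
  if q ∈ M.final then (q, γ, fun _ => .stay) else M.trans q γ

/-- The zones are merged in pairs after this row. -/
def RowInfo.expands (g : RowInfo k Q Γ) : Prop :=
  g.control = .init ∨ g.control = .scan ∧ g.atMiddle

/-- The scanning head reads the tape in this row. -/
def RowInfo.scans (g : RowInfo k Q Γ) : Prop :=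
  g.control = .scan ∧ ¬ g.atMiddle

open Classical in
/-- The control of the next row. -/
noncomputable def TuringMachine.nextControl (M : TuringMachine k Q Γ) (g : RowInfo k Q Γ) :
    Control Q :=
  match g.control with
  | .idle => .idle
  | .init => .run M.start
  | .run q => if g.atMiddle then .scan else .run (M.act q g.read).1
  | .scan => if g.atMiddle then .run M.start else .scan

open Classical in
/-- The cell in the next row, given the bit, the cell and its neighbours `l` and `r` in the
first direction. -/
noncomputable def TuringMachine.nextCell (M : TuringMachine k Q Γ) (g : RowInfo k Q Γ) (bit : Prop)
    (l c r : CellInfo k Γ) : CellInfo k Γ :=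
  if g.expands then
    { tape := fun _ => M.blank
      head := fun _ => c.mark ∧ bit
      scanner := c.mark ∧ bit
      mark := c.mark ∧ bit
      middle := c.mark ∧ ¬ bit }
  else
    match g.control with
    | .run q =>
      if g.atMiddle then { c with scanner := l.scanner }
      else
        { tape := fun j => if c.head j then (M.act q g.read).2.1 j else c.tape j
          head := fun j => match (M.act q g.read).2.2 j with
            | .left => r.head j
            | .stay => c.head j
            | .right => l.head j
          scanner := l.scanner
          mark := c.mark
          middle := c.middle }
    | _ => { c with scanner := l.scanner }

open Classical in
/-- The letter of the moving copy in the next row. -/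
noncomputable def PatternMachine.nextMoving (M : PatternMachine d A k Q Γ) (g : RowInfo k Q Γ)
    (x : A) (r l : Fin d → A) : A :=
  if g.scans then M.scanLetter g.scan x r l else x

/-- Whether the cell in the next row agrees with the word read so far. -/
def PatternMachine.nextAgrees (M : PatternMachine d A k Q Γ) (g : RowInfo k Q Γ) (y : A)
    (p : Prop) : Prop :=
  g.scans ∧ M.scanAgrees g.scan y p

/-- The label `u` may stand above `c`, whose neighbours are `r` and `l`. -/
structure PatternMachine.UpRule {N : ℕ} (M : PatternMachine d A k Q Γ)
    (c u : Label d N A k Q Γ) (r l : Fin d → Label d N A k Q Γ) : Prop where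
  control : u.row.control = M.nextControl c.row
  cell : u.cell = M.nextCell c.row c.bit (l 0).cell c.cell (r 0).cell
  fixed : u.fixed = c.fixed
  moving : u.moving = M.nextMoving c.row c.fixed (fun i => (r i).moving) fun i => (l i).moving
  agrees : u.agrees = M.nextAgrees c.row c.moving c.agrees

variable [NeZero k]

/-- The rule for the label `c` in its row, where `r` are its neighbours. -/
structure PatternMachine.RowRule {N : ℕ} (M : PatternMachine d A k Q Γ)
    (c : Label d N A k Q Γ) (r : Fin d → Label d N A k Q Γ) : Prop where
  phase : ∀ i, (r i).phase = c.phase + Pi.single i 1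
  row : ∀ i, (r i).row = c.row
  bit : ∀ i, i ≠ 0 → (r i).bit = c.bit
  mark : c.row.control = .init → c.cell.mark
  read : ∀ j, c.cell.head j → c.row.read j = c.cell.tape j
  -- The scanner is also the clock: its first arrival at a middle ends the run, the second one ends
  -- the phase.
  scanner : c.cell.scanner → c.row.scan = c.cell.tape 0 ∧ (c.row.atMiddle ↔ c.cell.middle)
  -- A bit that changes exactly at the marks selects every second mark.
  expands : c.row.expands → ((r 0).cell.mark ↔ ¬ ((r 0).bit ↔ c.bit))
  check : c.row.scans → c.row.scan = M.separator → ¬ c.agrees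

/-- The local rule of the subshift of finite type. -/
def PatternMachine.Rule {N : ℕ} (M : PatternMachine d A k Q Γ)
    (f : Neighbor d → Label d N A k Q Γ) : Prop :=
  M.RowRule (f .center) (fun i => f (.plus i)) ∧
  -- Above an idle row only the control is constrained, so the initial row may occur at any height
  -- or never.
  ((f .center).row.control = .idle →
    (f .up).row.control = .idle ∨ (f .up).row.control = .init) ∧
  ((f .center).row.control ≠ .idle →
    M.UpRule (f .center) (f .up) (fun i => f (.plus i)) fun i => f (.minus i))

end Rule

/-! ### The evolution of a zone -/

section Zone

variable {k : ℕ} {Q Γ : Type*} (M : TuringMachine k Q Γ)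

theorem TuringMachine.run_succ (t : ℕ) :
    M.run (t + 1) =
      let c := M.run t
      let next := M.act c.state fun j => c.tape j (c.head j)
      { state := next.1
        head := fun j => c.head j + (next.2.2 j).toInt
        tape := fun j => Function.update (c.tape j) (c.head j) (next.2.1 j) } := by
  simp only [TuringMachine.run, TuringMachine.step, TuringMachine.act]
  split_ifs with h
  · simp [HeadMove.toInt]
  · rfl

theorem TuringMachine.abs_head_le (t : ℕ) (j : Fin k) : |(M.run t).head j| ≤ t := by
  induction t with
  | zero => simp [TuringMachine.run]
  | succ t ih =>
    rw [TuringMachine.run_succ]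
    simp only [abs_le, Nat.cast_add, Nat.cast_one] at ih ⊢
    generalize ((M.act _ _).2.2 j) = m
    cases m <;> simp only [HeadMove.toInt] <;> omega

/-- Only cells under a head are written. Hence a scan of the positions from `-T + 1` to `T - 1` sees
all that was written in `T` steps. -/
theorem TuringMachine.abs_lt_of_tape_ne {t : ℕ} {j : Fin k} {i : ℤ}
    (h : (M.run t).tape j i ≠ M.blank) : |i| < t := by
  induction t with
  | zero => exact absurd rfl h
  | succ t ih =>
    rw [TuringMachine.run_succ] at h
    by_cases hi : i = (M.run t).head j
    · have := M.abs_head_le t j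
      rw [hi]
      push_cast
      omega
    · simp only [Function.update_of_ne hi] at h
      have := ih h
      push_cast
      omega

/-- The cells of row `s` of a phase with zones of width `2 * T`. -/
noncomputable def TuringMachine.zoneCell (T s : ℕ) (i : ℤ) : CellInfo k Γ where
  -- The tapes are frozen after `T` steps, while they are scanned.
  tape j := (M.run (min s T)).tape j (i.bmod (2 * T))
  head j := (2 * T : ℤ) ∣ i - (M.run (min s T)).head j
  scanner := (2 * T : ℤ) ∣ i - s
  mark := (2 * T : ℤ) ∣ i
  middle := (T : ℤ) ∣ i ∧ ¬ (2 * T : ℤ) ∣ i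

variable [NeZero k]

/-- The information which is constant along row `s` of a phase with zones of width `2 * T`. -/
noncomputable def TuringMachine.zoneRow (T s : ℕ) : RowInfo k Q Γ where
  control := if s ≤ T then .run (M.run s).state else .scan
  read j := (M.run (min s T)).tape j (((M.run (min s T)).head j).bmod (2 * T))
  scan := (M.run (min s T)).tape 0 ((s : ℤ).bmod (2 * T))
  -- Between these two rows the scanner sweeps exactly the residues from `-T + 1` to `T - 1`.
  atMiddle := s = T ∨ s = 3 * T

variable {M} {T s : ℕ}

theorem TuringMachine.zoneRow_expands (hT : 0 < T) : (M.zoneRow T s).expands ↔ s = 3 * T := by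
  simp only [RowInfo.expands, TuringMachine.zoneRow]
  split_ifs with h
  · simp
    omega
  · simp
    omega

theorem TuringMachine.zoneRow_scans (hs : s ≤ 3 * T) :
    (M.zoneRow T s).scans ↔ T < s ∧ s < 3 * T := by
  simp only [RowInfo.scans, TuringMachine.zoneRow]
  split_ifs with h
  · simp
    omega
  · simp
    omega

theorem TuringMachine.zoneRow_atMiddle (hT : 0 < T) (hs : s ≤ 3 * T) :
    (M.zoneRow T s).atMiddle ↔ (T : ℤ) ∣ s ∧ ¬ (2 * T : ℤ) ∣ s := by
  simp only [TuringMachine.zoneRow]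
  norm_cast
  constructor
  · rintro (rfl | rfl)
    · exact ⟨dvd_rfl, fun h => by have := Nat.le_of_dvd hT h; omega⟩
    · refine ⟨dvd_mul_left _ _, fun h => ?_⟩
      have := Nat.dvd_of_mul_dvd_mul_right hT h
      omega
  · rintro ⟨⟨q, rfl⟩, h⟩
    have hq : q ≤ 3 := by
      by_contra hq
      nlinarith
    interval_cases q
    · simp at h
    · simp
    · exact absurd (by rw [mul_comm]) h
    · right
      ring

theorem TuringMachine.nextControl_zoneRow (hT : 0 < T) (hs : s < 3 * T) :
    M.nextControl (M.zoneRow T s) = (M.zoneRow T (s + 1)).control := by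
  rcases lt_trichotomy s T with h | rfl | h
  · have hb : ((M.run s).head · |>.bmod (2 * T)) = (M.run s).head := by
      funext j
      have := abs_le.1 (M.abs_head_le s j)
      exact Int.bmod_eq_of_le (by omega) (by omega)
    rw [funext_iff] at hb
    simp [TuringMachine.nextControl, TuringMachine.zoneRow, h.le, h.ne, hs.ne, Nat.succ_le_of_lt h,
      TuringMachine.run_succ, hb]
  · simp [TuringMachine.nextControl, TuringMachine.zoneRow]
  · simp [TuringMachine.nextControl, TuringMachine.zoneRow, h.not_ge, h.ne', hs.ne,
      (Nat.lt_succ_of_lt h).not_ge]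

theorem bmod_eq_iff_dvd {T : ℕ} {i a : ℤ} (h1 : -(T : ℤ) ≤ a) (h2 : a < T) :
    i.bmod (2 * T) = a ↔ (2 * T : ℤ) ∣ i - a := by
  have ha : a.bmod (2 * T) = a := Int.bmod_eq_of_le (by omega) (by omega)
  rw [← ha]
  conv_rhs => rw [ha]
  rw [Int.bmod_eq_bmod_iff_bmod_sub_eq_zero, ← Int.dvd_iff_bmod_eq_zero]
  simp

/-- Before row `T` the heads are at distance less than `T` from their marks, so residues modulo `2 *
T` locate them and the zones do not interfere. From row `T` on only the scanner moves. -/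
theorem TuringMachine.nextCell_zoneCell (hT : 0 < T) (hs : s < 3 * T) (bit : Prop) (i : ℤ) :
    M.nextCell (M.zoneRow T s) bit (M.zoneCell T s (i - 1)) (M.zoneCell T s i)
      (M.zoneCell T s (i + 1)) = M.zoneCell T (s + 1) i := by
  have hexp : ¬ (M.zoneRow T s).expands := by
    rw [TuringMachine.zoneRow_expands hT]
    omega
  rw [TuringMachine.nextCell, if_neg hexp]
  have hsc : ((2 * T : ℤ) ∣ i - 1 - s) = ((2 * T : ℤ) ∣ i - (s + 1 : ℕ)) := by
    push_cast
    rw [sub_sub, add_comm]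
  rcases lt_or_ge s T with h | h
  · have hb : ∀ j, ((M.run s).head j).bmod (2 * T) = (M.run s).head j := by
      intro j
      have := abs_le.1 (M.abs_head_le s j)
      exact Int.bmod_eq_of_le (by omega) (by omega)
    have hd : ∀ j, (2 * T : ℤ) ∣ i - (M.run s).head j ↔ i.bmod (2 * T) = (M.run s).head j := by
      intro j
      have := abs_le.1 (M.abs_head_le s j)
      exact (bmod_eq_iff_dvd (by omega) (by omega)).symm
    have h1 : min s T = s := by omega
    have h2 : min (s + 1) T = s + 1 := by omega
    simp only [TuringMachine.zoneRow, TuringMachine.zoneCell, h1, h2, h.le, if_true, h.ne, hs.ne,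
      or_self, if_false, hb, hsc]
    ext j
    · simp only [hd, TuringMachine.run_succ, Function.update_apply]
    · simp only [TuringMachine.run_succ]
      generalize ((M.act _ _).2.2 j) = m
      cases m <;> simp only [HeadMove.toInt]
      · rw [show i + 1 - (M.run s).head j = i - ((M.run s).head j + -1) by ring]
      · simp
      · rw [show i - 1 - (M.run s).head j = i - ((M.run s).head j + 1) by ring]
    all_goals rfl
  · have h1 : min s T = T := by omega
    have h2 : min (s + 1) T = T := by omega
    have hif : s ≤ T → s = T := fun h' => le_antisymm h' h
    split
    · next q hq =>
      have : s = T := hif (by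
        by_contra hc
        simp [TuringMachine.zoneRow, hc] at hq)
      rw [if_pos (by simp [TuringMachine.zoneRow, this])]
      simp only [TuringMachine.zoneCell, h1, h2, hsc]
    · simp only [TuringMachine.zoneCell, h1, h2, hsc]

omit [NeZero k] in
-- Old marks with the bit become the new marks and those without it the new middles, so zones of
-- width `m` become zones of width `2 * m`.
theorem TuringMachine.nextCell_of_expands {g : RowInfo k Q Γ} (hg : g.expands) {m : ℕ}
    {i o : ℤ} {bit : Prop} {l c r : CellInfo k Γ} (hc : c.mark ↔ (m : ℤ) ∣ i) (ho : (m : ℤ) ∣ o)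
    (hb : (m : ℤ) ∣ i → (bit ↔ (2 * m : ℤ) ∣ i - o)) :
    M.nextCell g bit l c r = M.zoneCell m 0 (i - o) := by
  have h2 : (2 * m : ℤ) ∣ i - o → (m : ℤ) ∣ i := fun h =>
    (dvd_sub_left ho).1 ((dvd_mul_left _ _).trans h)
  rw [TuringMachine.nextCell, if_pos hg]
  simp only [TuringMachine.zoneCell, hc, Nat.zero_min, TuringMachine.run, Nat.cast_zero, sub_zero,
    dvd_sub_left ho]
  have h3 : ((m : ℤ) ∣ i ∧ bit) = ((2 * m : ℤ) ∣ i - o) := by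
    rw [eq_iff_iff]
    tauto
  have h4 : ((m : ℤ) ∣ i ∧ ¬ bit) = ((m : ℤ) ∣ i ∧ ¬ (2 * m : ℤ) ∣ i - o) := by
    rw [eq_iff_iff]
    tauto
  simp only [h3, h4]

theorem TuringMachine.nextControl_of_expands {g : RowInfo k Q Γ} (hg : g.expands) (T : ℕ) :
    M.nextControl g = (M.zoneRow T 0).control := by
  rcases hg with h | ⟨h, h'⟩
  · simp [TuringMachine.nextControl, TuringMachine.zoneRow, h, TuringMachine.run]
  · simp [TuringMachine.nextControl, TuringMachine.zoneRow, h, h', TuringMachine.run]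

/-- The row information is determined by the control and the cells. -/
theorem TuringMachine.eq_zoneRow {g : RowInfo k Q Γ} (hT : 0 < T) (hs : s ≤ 3 * T)
    (hctl : g.control = (M.zoneRow T s).control)
    (hread : ∀ i j, (M.zoneCell T s i).head j → g.read j = (M.zoneCell T s i).tape j)
    (hscan : ∀ i, (M.zoneCell T s i).scanner →
      g.scan = (M.zoneCell T s i).tape 0 ∧ (g.atMiddle ↔ (M.zoneCell T s i).middle)) :
    g = M.zoneRow T s := by
  -- Each head and the scanner occur somewhere in the row, so no component of the row information is
  -- left free.
  have h := hscan s (by simp [TuringMachine.zoneCell])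
  refine RowInfo.ext hctl (funext fun j => ?_) h.1 (propext ?_)
  · exact hread ((M.run (min s T)).head j) j (by simp [TuringMachine.zoneCell])
  · rw [h.2, TuringMachine.zoneRow_atMiddle hT hs]
    rfl

theorem TuringMachine.zoneRow_read {i : ℤ} {j : Fin k} (h : (M.zoneCell T s i).head j) :
    (M.zoneRow T s).read j = (M.zoneCell T s i).tape j := by
  simp only [TuringMachine.zoneRow, TuringMachine.zoneCell] at h ⊢
  congr 1
  rw [eq_comm, Int.bmod_eq_bmod_iff_bmod_sub_eq_zero, ← Int.dvd_iff_bmod_eq_zero]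
  simpa using h

theorem TuringMachine.zoneRow_scan {i : ℤ} (hT : 0 < T) (hs : s ≤ 3 * T)
    (h : (M.zoneCell T s i).scanner) :
    (M.zoneRow T s).scan = (M.zoneCell T s i).tape 0 ∧
      ((M.zoneRow T s).atMiddle ↔ (M.zoneCell T s i).middle) := by
  rw [TuringMachine.zoneRow_atMiddle hT hs]
  simp only [TuringMachine.zoneRow, TuringMachine.zoneCell] at h ⊢
  constructor
  · congr 1
    rw [eq_comm, Int.bmod_eq_bmod_iff_bmod_sub_eq_zero, ← Int.dvd_iff_bmod_eq_zero]
    simpa using h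
  · rw [← dvd_iff_dvd_of_dvd_sub h, ← dvd_iff_dvd_of_dvd_sub ((dvd_mul_left _ _).trans h)]

/-- The parity of `i / m` changes exactly at the multiples of `m`. -/
theorem dvd_succ_iff_parity {m : ℕ} (hm : 0 < m) (i : ℤ) :
    (m : ℤ) ∣ i + 1 ↔ ¬ (Even ((i + 1) / m) ↔ Even (i / m)) := by
  have hm' : (0 : ℤ) < m := by exact_mod_cast hm
  by_cases h : (m : ℤ) ∣ i + 1
  · obtain ⟨q, hq⟩ := h
    have h1 : (i + 1) / m = q := by rw [hq, Int.mul_ediv_cancel_left _ hm'.ne']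
    have h2 : i / m = q - 1 := by
      rw [Int.ediv_eq_iff_of_pos hm']
      constructor <;> nlinarith
    rw [h1, h2, hq, Int.even_sub_one]
    simp only [dvd_mul_right, true_iff]
    tauto
  · have : (i + 1) / m = i / m := by
      have h1 := Int.mul_ediv_add_emod i m
      have h2 := Int.emod_nonneg i hm'.ne'
      have h3 := Int.emod_lt_of_pos i hm'
      have h4 : i % m + 1 ≠ m := fun h4 => h ⟨i / m + 1, by linarith⟩
      rw [Int.ediv_eq_iff_of_pos hm']
      constructor
      · nlinarith
      · have : i % m + 1 < m := by omega
        nlinarith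
    simp [h, this]

theorem even_ediv_iff {m : ℕ} (hm : 0 < m) {i : ℤ} (h : (m : ℤ) ∣ i) :
    Even (i / m) ↔ (2 * m : ℤ) ∣ i := by
  have hm' : (m : ℤ) ≠ 0 := by exact_mod_cast hm.ne'
  obtain ⟨q, rfl⟩ := h
  rw [Int.mul_ediv_cancel_left _ hm', mul_comm (2 : ℤ), mul_dvd_mul_iff_left hm',
    even_iff_two_dvd]

/-- Bits which change exactly at the multiples of `m` select every second multiple of `m`. -/
theorem exists_offset_of_alternates {m : ℕ} (hm : 0 < m) {β : ℤ → Prop}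
    (h : ∀ i, (m : ℤ) ∣ i + 1 ↔ ¬ (β (i + 1) ↔ β i)) :
    ∃ o : ℤ, (m : ℤ) ∣ o ∧ ∀ i, (m : ℤ) ∣ i → (β i ↔ (2 * m : ℤ) ∣ i - o) := by
  -- `β` and the parity of `i / m` change at the same places, so they agree up to a global negation,
  -- which decides between `o = 0` and `o = m`.
  have key : ∀ i, β i ↔ (Even (i / m) ↔ β 0) := by
    have hstep : ∀ i, (β (i + 1) ↔ (Even ((i + 1) / m) ↔ β 0)) ↔
        (β i ↔ (Even (i / m) ↔ β 0)) := by
      intro i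
      have h1 := (h i).symm.trans (dvd_succ_iff_parity hm i)
      tauto
    intro i
    induction i using Int.induction_on with
    | zero => simp
    | succ i ih => exact (hstep _).2 ih
    | pred i ih =>
      rw [← hstep]
      simpa using ih
  by_cases h0 : β 0
  · refine ⟨0, dvd_zero _, fun i hi => ?_⟩
    rw [key i, even_ediv_iff hm hi]
    simp [h0]
  · refine ⟨m, dvd_rfl, fun i hi => ?_⟩
    have hm' : (m : ℤ) ≠ 0 := by exact_mod_cast hm.ne'
    rw [key i, ← even_ediv_iff hm ((dvd_sub_left dvd_rfl).2 hi)]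
    obtain ⟨q, rfl⟩ := hi
    rw [show (m : ℤ) * q - m = m * (q - 1) by ring, Int.mul_ediv_cancel_left _ hm',
      Int.mul_ediv_cancel_left _ hm', Int.even_sub_one]
    simp [h0]

end Zone

/-! ### The rows of the evolution -/

/-- The phase and the row of this phase to which row `h + 1` belongs. -/
def timePosition : ℕ → ℕ × ℕ
  | 0 => (0, 0)
  | h + 1 =>
    let p := timePosition h
    if p.2 = 3 * 2 ^ p.1 then (p.1 + 1, 0) else (p.1, p.2 + 1)

theorem timePosition_snd_le (h : ℕ) :
    (timePosition h).2 ≤ 3 * 2 ^ (timePosition h).1 ∧ (timePosition h).2 ≤ h := by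
  induction h with
  | zero => simp [timePosition]
  | succ h ih =>
    rw [timePosition]
    split_ifs <;> simp only <;> omega

/-- Phase `l` occupies `3 * 2 ^ l + 1` rows, so the earlier phases sum to `3 * (2 ^ l - 1) + l`. -/
theorem exists_timePosition_eq (l : ℕ) :
    ∃ h, h < 4 * 2 ^ l ∧ ∀ s, s ≤ 3 * 2 ^ l → timePosition (h + s) = (l, s) := by
  have step : ∀ l h, timePosition h = (l, 0) →
      ∀ s, s ≤ 3 * 2 ^ l → timePosition (h + s) = (l, s) := by
    intro l h h0 s hs
    induction s with
    | zero => exact h0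
    | succ s ih =>
      rw [← add_assoc, timePosition, ih (by omega)]
      dsimp only
      rw [if_neg (by omega)]
  induction l with
  | zero => exact ⟨0, by norm_num, step 0 0 rfl⟩
  | succ l ih =>
    obtain ⟨h, hh, hp⟩ := ih
    refine ⟨h + 3 * 2 ^ l + 1, by rw [pow_succ]; omega, step _ _ ?_⟩
    rw [timePosition, hp _ le_rfl]
    simp

section Configurations

variable {d : ℕ} [NeZero d] {A : Type*} {k : ℕ} [NeZero k] {Q Γ : Type*} {N : ℕ}
  (M : PatternMachine d A k Q Γ)

/-- The symbols read by the scanning head in a phase with zones of width `2 * T`. -/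
noncomputable def PatternMachine.scanWord (T n : ℕ) : Γ :=
  (M.run T).tape 0 (-T + 1 + n)

variable {M} {T s : ℕ}

omit [NeZero d] in
theorem PatternMachine.zoneRow_scan_eq (h1 : T < s) (h2 : s < 3 * T) :
    (M.zoneRow T s).scan = M.scanWord T (s - (T + 1)) := by
  have h3 : ((s : ℤ) - (2 * T : ℕ)).bmod (2 * T) = s - 2 * T := by
    push_cast
    exact Int.bmod_eq_of_le (by omega) (by omega)
  rw [Int.sub_bmod_right] at h3
  simp only [TuringMachine.zoneRow, PatternMachine.scanWord, h3]
  congr 1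
  · rw [min_eq_right h1.le]
  · omega

theorem PatternMachine.nextMoving_zoneRow (hs : s < 3 * T) (x : IntLattice d → A)
    (z : IntLattice d) :
    M.nextMoving (M.zoneRow T s) (x z)
      (fun i => (M.scanned (M.scanWord T) x (s - (T + 1))).1 (z + Pi.single i 1))
      (fun i => (M.scanned (M.scanWord T) x (s - (T + 1))).1 (z - Pi.single i 1)) =
    (M.scanned (M.scanWord T) x (s + 1 - (T + 1))).1 z := by
  rw [PatternMachine.nextMoving]
  split_ifs with h
  · rw [TuringMachine.zoneRow_scans hs.le] at h
    rw [show s + 1 - (T + 1) = s - (T + 1) + 1 by omega, PatternMachine.zoneRow_scan_eq h.1 hs]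
    rfl
  · rw [TuringMachine.zoneRow_scans hs.le] at h
    rw [show s + 1 - (T + 1) = 0 by omega]
    rfl

theorem PatternMachine.nextAgrees_zoneRow (hs : s < 3 * T) (x : IntLattice d → A)
    (z : IntLattice d) :
    M.nextAgrees (M.zoneRow T s) ((M.scanned (M.scanWord T) x (s - (T + 1))).1 z)
      ((M.scanned (M.scanWord T) x (s - (T + 1))).2 z) =
    (M.scanned (M.scanWord T) x (s + 1 - (T + 1))).2 z := by
  rw [PatternMachine.nextAgrees]
  by_cases h : T < s
  · rw [show s + 1 - (T + 1) = s - (T + 1) + 1 by omega, PatternMachine.zoneRow_scan_eq h hs,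
      eq_true ((TuringMachine.zoneRow_scans hs.le).2 ⟨h, hs⟩), true_and]
    rfl
  · rw [show s + 1 - (T + 1) = 0 by omega,
      eq_false fun h' => h ((TuringMachine.zoneRow_scans hs.le).1 h').1, false_and]
    rfl

omit [NeZero k] in
theorem RowInfo.expands.not_scans {g : RowInfo k Q Γ} (h : g.expands) : ¬ g.scans := by
  rintro ⟨h1, h2⟩
  rcases h with h | h
  · rw [h] at h1
    cases h1
  · exact h2 h.2

/-! #### Violations of the check -/

/-- The agreeing cell supplies `$ w` directly before the scanned separator, so `w` is completely
written at time `T`; soundness ensures that `w` describes a pattern at all. -/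
theorem PatternMachine.Enumerates.exists_appearsIn {F : Set (Pattern d A)} (hM : M.Enumerates F)
    (hs : s < 3 * T) (hTs : T < s) {x : IntLattice d → A} {z : IntLattice d}
    (hsep : (M.zoneRow T s).scan = M.separator)
    (hz : (M.scanned (M.scanWord T) x (s - (T + 1))).2 z) :
    ∃ p ∈ M.generated T, p.AppearsIn x := by
  obtain ⟨a, w, hn, ha, hw⟩ := PatternMachine.exists_word_of_scanned hz
  have hW : M.HasWritten T w := by
    refine ⟨-T + 1 + a, ha, fun j hj => ?_, ?_⟩
    · rw [← hw j hj, PatternMachine.scanWord]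
      congr 1
      push_cast
      ring
    · rw [← hsep, PatternMachine.zoneRow_scan_eq hTs hs, PatternMachine.scanWord, ← hn]
      congr 1
      push_cast
      ring
  obtain ⟨p, -, hp⟩ := hM.sound T w hW
  rw [← hn, (PatternMachine.scanned_of_word ha w hw).2 z] at hz
  exact ⟨p, ⟨w, hW, hp⟩, z, (hp.forall_iff x z).2 hz⟩

theorem PatternMachine.exists_scanned_of_appearsIn {x : IntLattice d → A} {p : Pattern d A}
    (hp : p ∈ M.generated T) (hx : p.AppearsIn x) :
    ∃ s z, T < s ∧ s < 3 * T ∧ (M.zoneRow T s).scan = M.separator ∧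
      (M.scanned (M.scanWord T) x (s - (T + 1))).2 z := by
  obtain ⟨w, ⟨i, h1, h2, h3⟩, hw⟩ := hp
  obtain ⟨z, hz⟩ := hx
  have hi := abs_lt.1 (M.abs_lt_of_tape_ne (h1 ▸ M.separator_ne_blank))
  have hi' := abs_lt.1 (M.abs_lt_of_tape_ne (h3 ▸ M.separator_ne_blank))
  obtain ⟨a, ha⟩ := Int.eq_ofNat_of_zero_le (a := i + T - 1) (by omega)
  have hσ : ∀ n : ℕ, M.scanWord T (a + n) = (M.run T).tape 0 (i + n) := by
    intro n
    rw [PatternMachine.scanWord]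
    congr 1
    omega
  -- This row scans the closing separator; index `0` of the scanned word belongs to row `T + 1`.
  refine ⟨T + 1 + (a + 1 + w.length), z, by omega, by omega, ?_, ?_⟩
  · rw [PatternMachine.zoneRow_scan_eq (by omega) (by omega), Nat.add_sub_cancel_left, add_assoc,
      hσ, ← h3]
    congr 1
    push_cast
    ring
  · rw [Nat.add_sub_cancel_left, (PatternMachine.scanned_of_word (by simpa [h1] using hσ 0) w
      fun j hj => ?_).2 z]
    · exact (hw.forall_iff x z).1 hz
    · rw [add_assoc, hσ, ← h2 j hj]
      congr 1
      push_cast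
      ring

/-! #### Configurations as families of rows -/

/-- The labels around a cell of a family of rows. -/
def neighborLabels {L : Type*} (W : ℤ → IntLattice d → L) (h : ℤ) (z : IntLattice d) :
    Neighbor d → L
  | .center => W h z
  | .up => W (h + 1) z
  | .plus i => W h (z + Pi.single i 1)
  | .minus i => W h (z - Pi.single i 1)

omit [NeZero d] in
theorem snoc_add_snoc (z z' : IntLattice d) (h h' : ℤ) :
    (Fin.snoc (α := fun _ => ℤ) z h : IntLattice (d + 1)) + Fin.snoc (α := fun _ => ℤ) z' h' =
      Fin.snoc (α := fun _ => ℤ) (z + z') (h + h') := by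
  funext i
  refine Fin.lastCases ?_ (fun i => ?_) i <;> simp

omit [NeZero d] in
theorem neighborLabels_eq {L : Type*} (Y : IntLattice (d + 1) → L) (h : ℤ) (z : IntLattice d) :
    (fun δ : Neighbor d => Y (Fin.snoc (α := fun _ => ℤ) z h + δ.offset)) =
      neighborLabels (fun h z => Y (Fin.snoc (α := fun _ => ℤ) z h)) h z := by
  funext δ
  cases δ <;> simp [Neighbor.offset, neighborLabels, snoc_add_snoc, sub_eq_add_neg]

omit [NeZero d] in
theorem snoc_add_offset_mem_strip (z : IntLattice d) (h : ℤ) (n : ℕ) :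
    (∀ δ : Neighbor d, (Fin.snoc (α := fun _ => ℤ) z h : IntLattice (d + 1)) + δ.offset ∈
      strip d n) ↔ -(n : ℤ) ≤ h ∧ h + 1 ≤ n := by
  constructor
  · intro H
    have h1 := H .center
    have h2 := H .up
    simp only [Neighbor.offset, strip, Set.mem_ofPred_eq, add_zero, snoc_add_snoc,
      Fin.snoc_last] at h1 h2
    omega
  · intro H δ
    cases δ <;> simp only [Neighbor.offset, strip, Set.mem_ofPred_eq, add_zero, snoc_add_snoc,
      Fin.snoc_last] <;> omega

omit [NeZero d] in
theorem forall_rule_iff {L : Type*} (rule : (Neighbor d → L) → Prop) (P : ℤ → Prop)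
    (c : IntLattice (d + 1) → Prop)
    (hc : ∀ z h, c (Fin.snoc (α := fun _ => ℤ) z h) ↔ P h) (x : IntLattice d → A)
    (out : L → A) :
    (∃ Y : IntLattice (d + 1) → L, (∀ i, c i → rule fun δ => Y (i + δ.offset)) ∧
      x = fun z => out (Y (Fin.snoc (α := fun _ => ℤ) z 0))) ↔
    ∃ W : ℤ → IntLattice d → L, (∀ h z, P h → rule (neighborLabels W h z)) ∧
      x = fun z => out (W 0 z) := by
  constructor
  · rintro ⟨Y, hY, rfl⟩
    refine ⟨fun h z => Y (Fin.snoc (α := fun _ => ℤ) z h), fun h z hP => ?_, rfl⟩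
    rw [← neighborLabels_eq]
    exact hY _ ((hc z h).2 hP)
  · rintro ⟨W, hW, rfl⟩
    refine ⟨fun i => W (i (Fin.last d)) (Fin.init i), fun i hi => ?_, by simp⟩
    rw [← Fin.snoc_init_self i] at hi ⊢
    refine (congrArg rule (neighborLabels_eq (fun i => W (i (Fin.last d)) (Fin.init i)) _ _)).mpr ?_
    simpa using hW _ _ ((hc _ _).1 hi)

omit [NeZero d] in
/-- A function which is invariant under the unit vectors outside of `s` depends only on the
coordinates in `s`. -/
theorem eq_of_invariant {α : Type*} {f : IntLattice d → α} {s : Set (Fin d)}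
    (hf : ∀ i, i ∉ s → ∀ z, f (z + Pi.single i 1) = f z) {z z' : IntLattice d}
    (hz : ∀ i ∈ s, z i = z' i) : f z = f z' := by
  classical
  have h1 : ∀ i, i ∉ s → ∀ (z : IntLattice d) (a : ℤ), f (z + Pi.single i a) = f z := by
    intro i hi z a
    induction a using Int.induction_on with
    | zero => simp
    | succ a ih => rw [← ih, Pi.single_add, ← add_assoc, hf i hi]
    | pred a ih => rw [← ih, ← hf i hi, add_assoc, ← Pi.single_add, sub_add_cancel]
  have h2 : ∀ t : Finset (Fin d), f (z + ∑ i ∈ t, Pi.single i (z' i - z i)) = f z := by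
    intro t
    induction t using Finset.induction_on with
    | empty => simp
    | insert i t hi ih =>
      rw [Finset.sum_insert hi, add_comm (Pi.single i _), ← add_assoc]
      by_cases his : i ∈ s
      · simpa [hz i his] using ih
      · rw [h1 i his, ih]
  rw [← h2 Finset.univ, Finset.univ_sum_single]
  congr 1
  funext i
  simp

end Configurations

/-! ### Soundness and completeness of the local rule -/

section Evolution

variable {d : ℕ} [NeZero d] {A : Type*} {k : ℕ} [NeZero k] {Q Γ : Type*} {N : ℕ}
  (M : PatternMachine d A k Q Γ)

/-- The label is the one at position `z` in row `s` of a phase with zones of width `2 * T`, where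
`x` is the fixed configuration and `o` is the first coordinate of a mark. -/
structure PatternMachine.IsZoneLabel (T s : ℕ) (x : IntLattice d → A) (o : ℤ) (z : IntLattice d)
    (c : Label d N A k Q Γ) : Prop where
  control : c.row.control = (M.zoneRow T s).control
  cell : c.cell = M.zoneCell T s (z 0 - o)
  fixed : c.fixed = x z
  moving : c.moving = (M.scanned (M.scanWord T) x (s - (T + 1))).1 z
  agrees : c.agrees = (M.scanned (M.scanWord T) x (s - (T + 1))).2 z

variable {M} {T s : ℕ} {x : IntLattice d → A} {o : ℤ}

/-- The forward direction serves soundness, the backward direction completeness. -/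
theorem PatternMachine.upRule_iff (hT : 0 < T) (hs : s < 3 * T)
    {c : IntLattice d → Label d N A k Q Γ} (hrow : ∀ z, (c z).row = M.zoneRow T s)
    (hc : ∀ z, M.IsZoneLabel T s x o z (c z)) (z : IntLattice d) (u : Label d N A k Q Γ) :
    M.UpRule (c z) u (fun i => c (z + Pi.single i 1)) (fun i => c (z - Pi.single i 1)) ↔
      M.IsZoneLabel T (s + 1) x o z u := by
  have h1 : M.nextControl (c z).row = (M.zoneRow T (s + 1)).control := by
    rw [hrow, TuringMachine.nextControl_zoneRow hT hs]
  have h2 : M.nextCell (c z).row (c z).bit (c (z - Pi.single 0 1)).cell (c z).cell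
      (c (z + Pi.single 0 1)).cell = M.zoneCell T (s + 1) (z 0 - o) := by
    rw [hrow, (hc _).cell, (hc _).cell, (hc _).cell,
      ← TuringMachine.nextCell_zoneCell hT hs (c z).bit]
    congr 2 <;> simp <;> ring
  have h3 := PatternMachine.nextMoving_zoneRow (M := M) hs x z
  have h4 := PatternMachine.nextAgrees_zoneRow (M := M) hs x z
  simp only [← (hc _).moving, ← (hc _).agrees, ← (hc _).fixed, ← hrow z] at h3 h4
  constructor
  · rintro ⟨a1, a2, a3, a4, a5⟩
    exact ⟨a1.trans h1, a2.trans h2, a3.trans (hc z).fixed, a4.trans h3, a5.trans h4⟩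
  · rintro ⟨a1, a2, a3, a4, a5⟩
    exact ⟨a1.trans h1.symm, a2.trans h2.symm, a3.trans (hc z).fixed.symm, a4.trans h3.symm,
      a5.trans h4.symm⟩

theorem PatternMachine.upRule_iff_of_expands {m : ℕ} {c : Label d N A k Q Γ} {z : IntLattice d}
    {o' : ℤ} (hexp : c.row.expands) (hmark : c.cell.mark ↔ (m : ℤ) ∣ z 0 - o)
    (hx : c.fixed = x z) (ho' : (m : ℤ) ∣ o')
    (hbit : (m : ℤ) ∣ z 0 - o → (c.bit ↔ (2 * m : ℤ) ∣ z 0 - o - o'))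
    (u : Label d N A k Q Γ) (r l : Fin d → Label d N A k Q Γ) :
    M.UpRule c u r l ↔ M.IsZoneLabel m 0 x (o + o') z u := by
  have h1 := TuringMachine.nextControl_of_expands (M := M.toTuringMachine) hexp m
  have h2 : M.nextCell c.row c.bit (l 0).cell c.cell (r 0).cell = M.zoneCell m 0 (z 0 - (o + o')) := by
    rw [← sub_sub]
    exact TuringMachine.nextCell_of_expands hexp hmark ho' hbit
  have h3 : M.nextMoving c.row c.fixed (fun i => (r i).moving) (fun i => (l i).moving) =
      (M.scanned (M.scanWord m) x (0 - (m + 1))).1 z := by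
    rw [PatternMachine.nextMoving, if_neg hexp.not_scans, hx, Nat.zero_sub]
    rfl
  have h4 : M.nextAgrees c.row c.moving c.agrees =
      (M.scanned (M.scanWord m) x (0 - (m + 1))).2 z := by
    rw [PatternMachine.nextAgrees, eq_false hexp.not_scans, false_and, Nat.zero_sub]
    rfl
  constructor
  · rintro ⟨a1, a2, a3, a4, a5⟩
    exact ⟨a1.trans h1, a2.trans h2, a3.trans hx, a4.trans h3, a5.trans h4⟩
  · rintro ⟨a1, a2, a3, a4, a5⟩
    exact ⟨a1.trans h1.symm, a2.trans h2.symm, a3.trans hx.symm, a4.trans h3.symm,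
      a5.trans h4.symm⟩

/-! #### Soundness -/

variable {W : ℤ → IntLattice d → Label d N A k Q Γ} {h : ℤ}

theorem PatternMachine.row_eq (hW : ∀ z, M.Rule (neighborLabels W h z)) (z z' : IntLattice d) :
    (W h z).row = (W h z').row :=
  eq_of_invariant (s := ∅) (f := fun z => (W h z).row) (fun i _ z => (hW z).1.row i) (by simp)

theorem PatternMachine.row_eq_zoneRow (hW : ∀ z, M.Rule (neighborLabels W h z)) (hT : 0 < T)
    (hs : s ≤ 3 * T) (hz : ∀ z, M.IsZoneLabel T s x o z (W h z)) (z : IntLattice d) :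
    (W h z).row = M.zoneRow T s := by
  have hcell : ∀ i : ℤ, (W h (Pi.single 0 (i + o))).cell = M.zoneCell T s i := by
    intro i
    rw [(hz _).cell]
    simp
  refine TuringMachine.eq_zoneRow hT hs (hz z).control (fun i j hj => ?_) fun i hi => ?_
  · rw [PatternMachine.row_eq hW z (Pi.single 0 (i + o)), ← hcell]
    exact (hW _).1.read j (by rw [← hcell] at hj; exact hj)
  · rw [PatternMachine.row_eq hW z (Pi.single 0 (i + o)), ← hcell]
    exact (hW _).1.scanner (by rw [← hcell] at hi; exact hi)

/-- The bits depend on the first coordinate only and alternate at the marks, but their global parity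
is free, whence an unspecified offset. -/
theorem PatternMachine.exists_isZoneLabel_of_expands {m : ℕ} (hm : 0 < m)
    (hW : ∀ z, M.Rule (neighborLabels W h z)) (hexp : ∀ z, (W h z).row.expands)
    (hmark : ∀ z, (W h z).cell.mark ↔ (m : ℤ) ∣ z 0 - o) (hx : ∀ z, (W h z).fixed = x z) :
    ∃ o', ∀ z, M.IsZoneLabel m 0 x o' z (W (h + 1) z) := by
  have hbit : ∀ z : IntLattice d, (W h z).bit = (W h (Pi.single 0 (z 0 - o + o))).bit := by
    intro z
    refine eq_of_invariant (s := {0}) (f := fun z => (W h z).bit)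
      (fun i hi z => (hW z).1.bit i (by simpa using hi)) ?_
    simp
  obtain ⟨o', ho', hb⟩ := exists_offset_of_alternates hm
    (β := fun i => (W h (Pi.single 0 (i + o))).bit) fun i => by
      have h1 := (hW (Pi.single 0 (i + o))).1.expands (hexp _)
      simp only [neighborLabels, hmark, ← Pi.single_add] at h1
      rw [show i + o + 1 = i + 1 + o by ring] at h1
      simpa using h1
  refine ⟨o + o', fun z => ?_⟩
  rw [← PatternMachine.upRule_iff_of_expands (hexp z) (hmark z) (hx z) ho' fun hz => ?_]
  · refine (hW z).2.2 fun (hc : (W h z).row.control = .idle) => ?_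
    rcases hexp z with h' | h'
    · rw [hc] at h'
      cases h'
    · rw [hc] at h'
      cases h'.1
  · rw [hbit z]
    exact hb _ hz

theorem PatternMachine.exists_isZoneLabel {n : ℕ}
    (hW : ∀ h : ℕ, h < n → ∀ z, M.Rule (neighborLabels W h z))
    (h0 : ∀ z, (W 0 z).row.control = .init) (hx : ∀ z, (W 0 z).fixed = x z) (h : ℕ) (hn : h < n) :
    ∃ o, ∀ z, M.IsZoneLabel (2 ^ (timePosition h).1) (timePosition h).2 x o z
      (W ((h + 1 : ℕ) : ℤ) z) := by
  induction h with
  | zero =>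
    -- Every cell of the initial row is a mark, so the initial zones have width `1`.
    have := PatternMachine.exists_isZoneLabel_of_expands (o := 0) (m := 1) one_pos
      (fun z => hW 0 hn z) (fun z => Or.inl (h0 z))
      (fun z => by simpa [neighborLabels] using (hW 0 hn z).1.mark (h0 z)) hx
    simpa [timePosition] using this
  | succ h ih =>
    obtain ⟨o, ho⟩ := ih (by omega)
    have hT : 0 < 2 ^ (timePosition h).1 := by positivity
    have hle := (timePosition_snd_le h).1
    have hrow := PatternMachine.row_eq_zoneRow (hW (h + 1) hn) hT hle ho
    rw [timePosition]
    split_ifs with hs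
    · have := PatternMachine.exists_isZoneLabel_of_expands (o := o)
        (m := 2 * 2 ^ (timePosition h).1) (by positivity) (hW (h + 1) hn)
        (fun z => by rw [hrow z]; exact (TuringMachine.zoneRow_expands hT).2 hs)
        (fun z => by rw [(ho z).cell]; simp [TuringMachine.zoneCell])
        (fun z => (ho z).fixed)
      rw [pow_succ, mul_comm]
      exact_mod_cast this
    · refine ⟨o, fun z => ?_⟩
      rw [← PatternMachine.upRule_iff hT (by omega) hrow ho z]
      refine (hW (h + 1) hn z).2.2 ?_
      show (W ((h + 1 : ℕ) : ℤ) z).row.control ≠ _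
      rw [hrow z, TuringMachine.zoneRow]
      dsimp only
      split_ifs <;> simp

/-- The initial row of a locally valid strip avoids the patterns generated in linear time. -/
theorem PatternMachine.Enumerates.mem_subshift_of_rule {F : Set (Pattern d A)}
    (hM : M.Enumerates F) {t : ℕ} (ht : 1 ≤ t)
    (hW : ∀ h : ℕ, h < 16 * t → ∀ z, M.Rule (neighborLabels W h z))
    (h0 : ∀ z, (W 0 z).row.control = .init) :
    (fun z => (W 0 z).fixed) ∈ subshift (M.generated t) := by
  intro p hp hx
  -- The chosen phase simulates more than `t` and at most `2 * t` steps.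
  have h1 : t < 2 ^ (Nat.log 2 t + 1) := Nat.lt_pow_succ_log_self (by norm_num) t
  have h2 : 2 ^ (Nat.log 2 t + 1) ≤ 2 * t := by
    rw [pow_succ, mul_comm]
    exact Nat.mul_le_mul_left 2 (Nat.pow_log_le_self 2 (by omega))
  generalize Nat.log 2 t + 1 = l at h1 h2
  obtain ⟨s, z, hs1, hs2, hsep, hz⟩ :=
    PatternMachine.exists_scanned_of_appearsIn (hM.generated_mono h1.le hp) hx
  obtain ⟨h, hh, hp⟩ := exists_timePosition_eq l
  obtain ⟨o, ho⟩ := PatternMachine.exists_isZoneLabel hW h0 (fun _ => rfl) (h + s) (by omega)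
  rw [hp s hs2.le] at ho
  -- Indeed `h < 4 * 2 ^ l`, `s < 3 * 2 ^ l` and `2 ^ l ≤ 2 * t`, so the row lies below `14 * t`.
  have hlt : h + s + 1 < 16 * t := by omega
  have hrow := PatternMachine.row_eq_zoneRow (hW _ hlt) (by positivity) hs2.le ho z
  refine (hW _ hlt z).1.check ?_ ?_ ?_
  · rw [show (neighborLabels W _ z .center).row = _ from hrow]
    exact (TuringMachine.zoneRow_scans hs2.le).2 ⟨hs1, hs2⟩
  · rw [show (neighborLabels W _ z .center).row = _ from hrow]
    exact hsep
  · rw [show (neighborLabels W _ z .center).agrees = _ from (ho z).agrees]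
    exact hz

/-! #### Completeness -/

variable (M N) in
/-- The labels of the evolution which checks `x`. -/
noncomputable def PatternMachine.evolution (x : IntLattice d → A) :
    ℤ → IntLattice d → Label d N A k Q Γ
  | .negSucc _, z =>
    { phase := fun i => z i
      row := ⟨.idle, fun _ => M.blank, M.blank, False⟩
      cell := ⟨fun _ => M.blank, fun _ => False, False, True, False⟩
      bit := False
      fixed := x z
      moving := x z
      agrees := False }
  | .ofNat 0, z =>
    { phase := fun i => z i
      row := ⟨.init, fun _ => M.blank, M.blank, False⟩
      cell := ⟨fun _ => M.blank, fun _ => False, False, True, False⟩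
      bit := Even (z 0)
      fixed := x z
      moving := x z
      agrees := False }
  | .ofNat (h + 1), z =>
    let T := 2 ^ (timePosition h).1
    let s := (timePosition h).2
    { phase := fun i => z i
      row := M.zoneRow T s
      cell := M.zoneCell T s (z 0)
      bit := Even (z 0 / ((2 * T : ℕ) : ℤ))
      fixed := x z
      moving := (M.scanned (M.scanWord T) x (s - (T + 1))).1 z
      agrees := (M.scanned (M.scanWord T) x (s - (T + 1))).2 z }

theorem PatternMachine.evolution_isZoneLabel (x : IntLattice d → A) (h : ℕ) (z : IntLattice d) :
    M.IsZoneLabel (2 ^ (timePosition h).1) (timePosition h).2 x 0 z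
      (M.evolution N x ((h + 1 : ℕ) : ℤ) z) :=
  ⟨rfl, by rw [sub_zero]; rfl, rfl, rfl, rfl⟩

theorem PatternMachine.evolution_phase (x : IntLattice d → A) (h : ℤ) (z : IntLattice d) :
    (M.evolution N x h z).phase = fun i => (z i : ZMod N) := by
  rcases h with (_ | h) | h <;> rfl

theorem PatternMachine.evolution_phase_add (x : IntLattice d → A) (h : ℤ) (z : IntLattice d)
    (i : Fin d) : (M.evolution N x h (z + Pi.single i 1)).phase =
      (M.evolution N x h z).phase + Pi.single i 1 := by
  rw [PatternMachine.evolution_phase, PatternMachine.evolution_phase]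
  funext j
  rcases eq_or_ne j i with rfl | hj <;> simp [*]

theorem PatternMachine.evolution_rule_of_neg (x : IntLattice d → A) (h : ℕ) (z : IntLattice d) :
    M.Rule (neighborLabels (M.evolution N x) (.negSucc h) z) := by
  refine ⟨⟨fun _ => PatternMachine.evolution_phase_add x (.negSucc h) z _, fun _ => rfl,
    fun _ _ => rfl, fun _ => trivial, fun _ => False.elim, False.elim, ?_, ?_⟩, fun _ => ?_,
    fun hc => (hc rfl).elim⟩
  · rintro (h | ⟨h, -⟩) <;> cases h
  · rintro ⟨h, -⟩
    cases h
  · cases h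
    · exact Or.inr rfl
    · exact Or.inl rfl

theorem PatternMachine.evolution_rule_zero (x : IntLattice d → A) (z : IntLattice d) :
    M.Rule (neighborLabels (M.evolution N x) 0 z) := by
  have hbit : ∀ z : IntLattice d, (M.evolution N x 0 z).bit = Even (z 0) := fun _ => rfl
  have hmark : ∀ z : IntLattice d, (M.evolution N x 0 z).cell.mark = True := fun _ => rfl
  refine ⟨⟨fun _ => PatternMachine.evolution_phase_add x 0 z _, fun _ => rfl, fun i hi => ?_,
    fun _ => trivial, fun _ => False.elim, False.elim, fun _ => ?_, ?_⟩,
    fun hc => (by cases hc), fun _ => ?_⟩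
  · simp [neighborLabels, hbit, hi.symm]
  · simp only [neighborLabels, hbit, hmark, Pi.add_apply, Pi.single_eq_same, Int.even_add_one]
    tauto
  · rintro ⟨h, -⟩
    cases h
  · refine (PatternMachine.upRule_iff_of_expands (x := x) (m := 1) (o := 0) (o' := 0) (z := z)
      (Or.inl rfl) ?_ rfl (dvd_zero _) ?_ _ _ _).2 ?_
    · simp [neighborLabels, hmark]
    · simp [neighborLabels, hbit, even_iff_two_dvd]
    · exact PatternMachine.evolution_isZoneLabel x 0 z

theorem PatternMachine.Enumerates.evolution_rule_succ {F : Set (Pattern d A)}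
    (hM : M.Enumerates F) {n : ℕ} (hx : x ∈ subshift (M.generated n)) {h : ℕ} (hn : h ≤ n)
    (z : IntLattice d) : M.Rule (neighborLabels (M.evolution N x) ((h + 1 : ℕ) : ℤ) z) := by
  have hl := PatternMachine.evolution_isZoneLabel (M := M) (N := N) x h
  have hl' := PatternMachine.evolution_isZoneLabel (M := M) (N := N) x (h + 1) z
  have hrow : ∀ z, (M.evolution N x ((h + 1 : ℕ) : ℤ) z).row =
      M.zoneRow (2 ^ (timePosition h).1) (timePosition h).2 := fun _ => rfl
  have hbit : ∀ z, (M.evolution N x ((h + 1 : ℕ) : ℤ) z).bit =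
      Even (z 0 / ((2 * 2 ^ (timePosition h).1 : ℕ) : ℤ)) := fun _ => rfl
  have hcell : ∀ z, (M.evolution N x ((h + 1 : ℕ) : ℤ) z).cell =
      M.zoneCell (2 ^ (timePosition h).1) (timePosition h).2 (z 0) := fun _ => rfl
  have hfix : ∀ z, (M.evolution N x ((h + 1 : ℕ) : ℤ) z).fixed = x z := fun _ => rfl
  have hsh := timePosition_snd_le h
  rw [timePosition] at hl'
  generalize hL : (timePosition h).1 = L at *
  generalize (timePosition h).2 = s at *
  have hT : 0 < 2 ^ L := by positivity
  generalize hTL : 2 ^ L = T at *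
  have hctl : ¬ (M.evolution N x ((h + 1 : ℕ) : ℤ) z).row.control = .idle := by
    rw [hrow, TuringMachine.zoneRow]
    dsimp only
    split_ifs <;> simp
  refine ⟨⟨fun _ => PatternMachine.evolution_phase_add x ((h + 1 : ℕ) : ℤ) z _, fun _ => ?_,
    fun i hi => ?_, fun hi => ?_,
    fun j hj => ?_, fun hj => ?_, fun hexp => ?_, fun hs hsep hz => ?_⟩,
    fun hc => (hctl hc).elim, fun _ => ?_⟩
  · simp only [neighborLabels, hrow]
  · simp only [neighborLabels, hbit, Pi.add_apply, Pi.single_eq_of_ne hi.symm, add_zero]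
  · simp only [neighborLabels, hrow, TuringMachine.zoneRow] at hi
    split_ifs at hi
  · simp only [neighborLabels, hrow, hcell] at hj ⊢
    exact TuringMachine.zoneRow_read hj
  · simp only [neighborLabels, hrow, hcell] at hj ⊢
    exact TuringMachine.zoneRow_scan hT hsh.1 hj
  · have := dvd_succ_iff_parity (m := 2 * T) (by omega) (z 0)
    simp only [neighborLabels, hbit, hcell, TuringMachine.zoneCell, Pi.add_apply,
      Pi.single_eq_same]
    exact_mod_cast this
  · simp only [neighborLabels, hrow, (hl _).agrees] at hs hsep hz
    rw [TuringMachine.zoneRow_scans hsh.1] at hs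
    obtain ⟨p, hp, hpx⟩ := hM.exists_appearsIn hs.2 hs.1 hsep hz
    -- A scan takes place only if `T < s`, and `s ≤ h ≤ n`, so the patterns checked are generated by
    -- time `n`.
    exact hx p (hM.generated_mono (by omega) hp) hpx
  · split_ifs at hl' with hs
    · refine (PatternMachine.upRule_iff_of_expands (x := x) (m := 2 * T) (o := 0) (o' := 0)
        (z := z) ?_ ?_ (hfix z) (dvd_zero _) ?_ _ _ _).2 ?_
      · show RowInfo.expands (M.evolution N x ((h + 1 : ℕ) : ℤ) z).row
        rw [hrow]
        exact (TuringMachine.zoneRow_expands hT).2 hs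
      · show (M.evolution N x ((h + 1 : ℕ) : ℤ) z).cell.mark ↔ _
        rw [hcell]
        simp [TuringMachine.zoneCell]
      · intro hd
        show (M.evolution N x ((h + 1 : ℕ) : ℤ) z).bit ↔ _
        rw [hbit, sub_zero, sub_zero]
        exact even_ediv_iff (by omega) (by simpa using hd)
      · rw [pow_succ, hTL, mul_comm] at hl'
        exact hl'
    · exact (PatternMachine.upRule_iff hT (by omega) hrow hl z _).2 (by rw [hTL] at hl'; exact hl')

/-- If `x` avoids the patterns generated in `n` steps, then the evolution of `x` obeys the local
rule in the rows up to `n`. -/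
theorem PatternMachine.Enumerates.evolution_rule {F : Set (Pattern d A)} (hM : M.Enumerates F)
    {n : ℕ} (hx : x ∈ subshift (M.generated n)) {h : ℤ} (hn : h ≤ n) (z : IntLattice d) :
    M.Rule (neighborLabels (M.evolution N x) h z) := by
  rcases h with (_ | h) | h
  · exact PatternMachine.evolution_rule_zero x z
  · exact hM.evolution_rule_succ hx (by simp at hn; omega) z
  · exact PatternMachine.evolution_rule_of_neg x h z

end Evolution

/-! ### The periodic point and the conclusion -/

theorem mainTheorem2 {d : ℕ} [NeZero d] {A : Type*} [Finite A]
    (S : Set (IntLattice d → A)) (F : Set (Pattern d A)) (hS : S = subshift F)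
    (hper : ∃ x ∈ S, IsPeriodicPoint x)
    {k : ℕ} [NeZero k] {Q Γ : Type*} [Finite Q] [Finite Γ]
    (M : PatternMachine d A k Q Γ) (hM : M.Enumerates F) :
    ∃ (B : Type) (_ : Finite B) (G : Set (Pattern (d + 1) B)) (_ : G.Finite)
      (π : FactorMap (d + 1) B A),
      (fun x => subaction (π.apply x)) '' subshift G = S ∧
      SpeedEquiv (convergenceSpeed G π) (M.enumTime F) := by
  classical
  subst hS
  by_cases hF : subshift F = Set.univ
  · exact exists_sft_of_subshift_eq_univ hF M
  obtain ⟨x₀, hx₀, N, hN, hper⟩ := hper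
  have : NeZero N := ⟨hN.ne'⟩
  let out : Label d N A k Q Γ → A := fun c =>
    if c.row.control = .init then c.fixed else x₀ fun i => (c.phase i).val
  -- By periodicity `x₀` may be read at representatives modulo `N`, and an unknown initial phase
  -- only translates it.
  have hphase : ∀ c : Fin d → ZMod N, (fun z : IntLattice d => x₀ fun i => (c i + z i).val) =
      fun z => x₀ (z + fun i => ((c i).val : ℤ)) := by
    intro c
    funext z
    have hdvd : ∀ i, ∃ q : ℤ, ((c i + z i).val : ℤ) = z i + (c i).val + N * q := by
      intro i
      have h : (((c i + z i).val : ℤ) : ZMod N) = ((z i + (c i).val : ℤ) : ZMod N) := by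
        simp [add_comm]
      obtain ⟨q, hq⟩ := (ZMod.intCast_eq_intCast_iff_dvd_sub _ _ N).1 h.symm
      exact ⟨q, by linarith⟩
    choose q hq using hdvd
    rw [← hper (z + _) q]
    congr 1
    funext i
    rw [hq]
    simp
  have idle_mem : ∀ {W : ℤ → IntLattice d → Label d N A k Q Γ},
      (∀ z, M.Rule (neighborLabels W 0 z)) → (W 0 0).row.control ≠ .init →
      (fun z => out (W 0 z)) ∈ subshift F := by
    intro W hW h0
    -- The difference of the phase and the position modulo `N` is invariant under all unit vectors.
    have h1 : ∀ z, (W 0 z).phase = fun i => (W 0 0).phase i + z i := by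
      intro z
      have h2 := eq_of_invariant (s := ∅)
        (f := fun z : IntLattice d => (W 0 z).phase - fun i => (z i : ZMod N)) (z := z) (z' := 0)
        (fun i _ z => by
          have h3 := (hW z).1.phase i
          simp only [neighborLabels] at h3
          rw [h3]
          funext j
          rcases eq_or_ne j i with rfl | hj <;> simp [*]) (by simp)
      funext i
      have h3 := congrFun h2 i
      simp only [Pi.sub_apply, Pi.zero_apply, Int.cast_zero, sub_zero] at h3
      rw [← h3, sub_add_cancel]
    have h2 : (fun z => out (W 0 z)) = fun z => x₀ (z + fun i => (((W 0 0).phase i).val : ℤ)) := by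
      rw [← hphase]
      funext z
      simp only [out]
      rw [if_neg (by rwa [PatternMachine.row_eq hW z 0]), h1 z]
    rw [h2]
    exact mem_subshift_translate hx₀ _
  have init_eq : ∀ {W : ℤ → IntLattice d → Label d N A k Q Γ},
      (∀ z, M.Rule (neighborLabels W 0 z)) → (W 0 0).row.control = .init →
      (∀ z, (W 0 z).row.control = .init) ∧ (fun z => out (W 0 z)) = fun z => (W 0 z).fixed := by
    intro W hW h0
    have h1 : ∀ z, (W 0 z).row.control = .init := fun z => by
      rwa [PatternMachine.row_eq hW z 0]
    exact ⟨h1, funext fun z => if_pos (h1 z)⟩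
  have hout : ∀ x : IntLattice d → A, x = fun z => out (M.evolution N x 0 z) := fun x =>
    funext fun z => (if_pos rfl).symm
  obtain ⟨B, hB, G, hG, π, hsub, happ, hnb⟩ :=
    exists_sft_of_rule (Neighbor.offset (d := d)) (M.Rule (N := N)) out
  have hsub' : (fun x => subaction (π.apply x)) '' subshift G = {x |
      ∃ W : ℤ → IntLattice d → Label d N A k Q Γ,
        (∀ h z, True → M.Rule (neighborLabels W h z)) ∧ x = fun z => out (W 0 z)} := by
    rw [hsub]
    ext x
    simpa only [Set.mem_ofPred_eq, true_imp_iff] using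
      forall_rule_iff (M.Rule (N := N)) (fun _ => True) (fun _ => True) (fun _ _ => Iff.rfl) x out
  have happ' : ∀ n : ℕ, (fun x => subaction (π.apply x)) '' approxRow G n = {x |
      ∃ W : ℤ → IntLattice d → Label d N A k Q Γ,
        (∀ h z, -(n : ℤ) ≤ h ∧ h + 1 ≤ n → M.Rule (neighborLabels W h z)) ∧
        x = fun z => out (W 0 z)} := by
    intro n
    rw [happ n]
    ext x
    exact forall_rule_iff (M.Rule (N := N)) (fun h => -(n : ℤ) ≤ h ∧ h + 1 ≤ n) _
      (fun z h => snoc_add_offset_mem_strip z h n) x out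
  have hle : ∀ t : ℕ, 1 ≤ t →
      (fun x => subaction (π.apply x)) '' approxRow G (16 * t) ⊆ subshift (M.generated t) := by
    intro t ht
    rw [happ']
    rintro x ⟨W, hW, rfl⟩
    have hW' : ∀ h : ℕ, h < 16 * t → ∀ z, M.Rule (neighborLabels W h z) :=
      fun h hh z => hW h z (by push_cast; omega)
    -- The control is constant along row `0`, so the whole row outputs either the fixed copy or a
    -- translate of `x₀`.
    by_cases h0 : (W 0 0).row.control = .init
    · obtain ⟨h1, h2⟩ := init_eq (hW' 0 (by omega)) h0
      rw [h2]
      exact hM.mem_subshift_of_rule ht hW' h1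
    · exact hM.subshift_subset t (idle_mem (hW' 0 (by omega)) h0)
  have hge : ∀ n : ℕ,
      subshift (M.generated n) ⊆ (fun x => subaction (π.apply x)) '' approxRow G n := by
    intro n x hx
    rw [happ']
    exact ⟨M.evolution N x, fun h z hh => hM.evolution_rule hx (by omega) z, hout x⟩
  have heq : (fun x => subaction (π.apply x)) '' subshift G = subshift F := by
    refine Set.Subset.antisymm (fun x hx => hM.mem_subshift fun t => ?_) fun x hx => ?_
    · rw [hsub'] at hx
      obtain ⟨W, hW, rfl⟩ := hx
      have hx : (fun z => out (W 0 z)) ∈ subshift (M.generated (t + 1)) := by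
        refine hle (t + 1) (by omega) ?_
        rw [happ']
        exact ⟨W, fun h z _ => hW h z trivial, rfl⟩
      exact fun p hp => hx p (hM.generated_mono (Nat.le_succ t) hp)
    · rw [hsub']
      exact ⟨M.evolution N x, fun h z _ =>
        hM.evolution_rule (n := h.toNat) (hM.subshift_subset _ hx) (Int.self_le_toNat h) z, hout x⟩
  exact ⟨B, hB, G, hG, π, heq, speedEquiv_of_subset hM hF (by norm_num) heq hnb hle hge⟩
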